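/- **Proposition (Correctness of the computeFlow algorithm for the proximal operator).** Let $p\ge 0$, let $u\in\mathbb R^p$, let $\mathcal G$ be a finite family of (arbitrary, possibly overlapping) groups $g\subseteq\{1,\dots,p\}$, let $\eta_g>0$ for $g\in\mathcal G$, and let $\lambda\ge 0$. Put $$\Omega(w)=\sum_{g\in\mathcal G}\eta_g\max_{j\in g}|w_j|$$ (a maximum over an empty group being $0$). *Graphs.* A graph here has a vertex set $V=V_{gr}\cup V_u$ of group and variable vertices, a source $s$, a sink $t$, an arc $(s,g)$ of capacity $\lambda\eta_g$ for each $g\in V_{gr}$, an arc $(j,t)$ for each $j\in V_u$, and a set $E$ of further arcs inside $V$, all of infinite capacity and zero cost. The *canonical graph* of $\mathcal G$ has $V_{gr}=\mathcal G$, $V_u=\{1,\dots,p\}$ and $E=\{(g,j): j\in g\}$. A graph with the same vertices $V$ is *equivalent* to it if for every $g\in\mathcal G$ and $j\in g$ it has exactly one directed path from $g$ to $j$ inside $V$ (paths do not repeat vertices), and it has no path inside $V$ from a group $g$ to a variable $j\notin g$. The canonical graph is equivalent to itself. *Procedure* $\mathtt{computeFlow}(V,E)$, for a vector $a\in\mathbb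 R_{\ge 0}^p$: 1. Let $\gamma=(\gamma_j)_{j\in V_u}$ minimize $\sum_{j\in V_u}\frac12(a_j-\gamma_j)^2$ subject to $\sum_{j\in V_u}|\gamma_j|\le\lambda\sum_{g\in V_{gr}}\eta_g$. 2. Give each arc $(j,t)$ the capacity $\gamma_j$, compute a maximum $(s,t)$-flow, and let $\bar\xi_j$ be its value on $(j,t)$. 3. If $\bar\xi_j=\gamma_j$ for all $j\in V_u$, return $\bar\xi$. Otherwise take a minimum $(s,t)$-cut of this network; let $V^+$ and $V^-$ be the parts of $V$ on the side of $s$ and on the side of $t$, let $E^\pm$ be the arcs of $E$ inside $V^\pm$, and return the vector formed by $\mathtt{computeFlow}(V^+,E^+)$ on $V_u\cap V^+$ and $\mathtt{computeFlow}(V^-,E^-)$ on $V_u\cap V^-$. *Algorithm.* Run $\mathtt{computeFlow}$ for $a=(|u_j|)_j$ on a graph that is equivalent to the canonical graph of $\mathcal G$ (for instance on the canonical graph itself), obtain $\bar\xi$, and return the vector $w$ with $w_j=u_j-\bar\xi_j$ if $u_j\ge 0$ and $w_j=u_j+\bar\xi_j$ if $u_j<0$. In particular $w=u-\bar\xi$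 if all $u_j$ are non-negative. Then, whichever maximum flows and minimum cuts are used in the calls, every step can be carried out and the algorithm stops after finitely many calls, and: * $\bar\xi$ solves the quadratic min-cost flow problem on the given graph exactly: if the arcs $(j,t)$ are given infinite capacity and cost $\frac12(|u_j|-x_j)^2$, where $x_j$ is the flow on $(j,t)$, and all other arcs zero cost, then some flow of minimal cost has the values $\bar\xi_j$ on the arcs $(j,t)$; * the returned vector $w$ is the unique solution of the proximal problem $$\min_{w\in\mathbb R^p}\ \tfrac12\|u-w\|_2^2+\lambda\,\Omega(w).$$ -/

import Mathlib

open scoped ENNReal NNReal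

noncomputable section

namespace ProxFlow

/-! ### Flow networks: flows, maximum flows, minimum cuts -/

/-- A directed graph `(V, E, s, t)` with a source, a sink and capacities in `[0, ∞]`. -/
structure FlowNetwork (N : Type*) where
  verts : Finset N
  arcs : Finset (N × N)
  source : N
  sink : N
  cap : N × N → ℝ≥0∞
  source_mem : source ∈ verts
  sink_mem : sink ∈ verts
  source_ne_sink : source ≠ sink
  arcs_mem : ∀ e ∈ arcs, e.1 ∈ verts ∧ e.2 ∈ verts

namespace FlowNetwork

variable {N : Type*} [DecidableEq N]

/-- The total amount that `f` carries into the vertex `v`. -/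
def inflow (K : FlowNetwork N) (f : N × N → ℝ) (v : N) : ℝ :=
  ∑ e ∈ K.arcs with e.2 = v, f e

/-- The total amount that `f` carries out of the vertex `v`. -/
def outflow (K : FlowNetwork N) (f : N × N → ℝ) (v : N) : ℝ :=
  ∑ e ∈ K.arcs with e.1 = v, f e

/-- A flow: non-negative, bounded by the capacities on all arcs, and conserved at every vertex
other than the source and the sink. Values of `f` outside the arc set play no role. -/
structure IsFlow (K : FlowNetwork N) (f : N × N → ℝ) : Prop where
  nonneg : ∀ e ∈ K.arcs, 0 ≤ f e
  le_cap : ∀ e ∈ K.arcs, ENNReal.ofReal (f e) ≤ K.cap e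
  conserved : ∀ v ∈ K.verts, v ≠ K.source → v ≠ K.sink → K.inflow f v = K.outflow f v

/-- The value of a flow: what leaves the source minus what enters it. -/
def value (K : FlowNetwork N) (f : N × N → ℝ) : ℝ :=
  K.outflow f K.source - K.inflow f K.source

def IsMaxFlow (K : FlowNetwork N) (f : N × N → ℝ) : Prop :=
  K.IsFlow f ∧ ∀ f', K.IsFlow f' → K.value f' ≤ K.value f

/-- `S` is the source side of an `(s,t)`-cut. -/
def IsCut (K : FlowNetwork N) (S : Finset N) : Prop :=
  S ⊆ K.verts ∧ K.source ∈ S ∧ K.sink ∉ S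

def cutCapacity (K : FlowNetwork N) (S : Finset N) : ℝ≥0∞ :=
  ∑ e ∈ K.arcs with e.1 ∈ S ∧ e.2 ∉ S, K.cap e

def IsMinCut (K : FlowNetwork N) (S : Finset N) : Prop :=
  K.IsCut S ∧ ∀ S', K.IsCut S' → K.cutCapacity S ≤ K.cutCapacity S'

end FlowNetwork

/-! ### Graphs on groups and variables

The groups are indexed by `ι` and the variables by `κ`; the vertex of the group `g` is `Sum.inl g`
and the vertex of the variable `j` is `Sum.inr j`. -/

/-- A graph on a set `V = V_gr ∪ V_u` of group and variable vertices. Only the arcs between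
vertices of `V` are recorded here: the arcs `(s, g)` for all `g ∈ V_gr` and `(j, t)` for all
`j ∈ V_u` are the same for every such graph, and `GroupGraph.network` adds them. -/
structure GroupGraph (ι κ : Type*) where
  verts : Finset (ι ⊕ κ)
  arcs : Finset ((ι ⊕ κ) × (ι ⊕ κ))
  arcs_mem : ∀ e ∈ arcs, e.1 ∈ verts ∧ e.2 ∈ verts

/-- Vertices of the complete network: the source, the sink, and the groups and variables. -/
inductive Node (ι κ : Type*) where
  | source : Node ι κ
  | sink : Node ι κ
  | inner (x : ι ⊕ κ) : Node ι κ
  deriving DecidableEq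

namespace GroupGraph

variable {ι κ : Type*} [DecidableEq ι] [DecidableEq κ]

/-- The set `V_gr` of group vertices. -/
def groups (G : GroupGraph ι κ) : Finset ι := G.verts.toLeft

/-- The set `V_u` of variable vertices. -/
def vars (G : GroupGraph ι κ) : Finset κ := G.verts.toRight

/-- The subgraph induced on the vertices that satisfy `P`. -/
def induce (G : GroupGraph ι κ) (P : ι ⊕ κ → Prop) [DecidablePred P] : GroupGraph ι κ where
  verts := G.verts.filter P
  arcs := G.arcs.filter fun e => P e.1 ∧ P e.2
  arcs_mem := by
    intro e he
    rw [Finset.mem_filter] at he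
    have h := G.arcs_mem e he.1
    exact ⟨Finset.mem_filter.2 ⟨h.1, he.2.1⟩, Finset.mem_filter.2 ⟨h.2, he.2.2⟩⟩

/-- The capacity of an arc of the complete network: `a g` on `(s, g)`, `b j` on `(j, t)`, and `∞`
on every other arc. -/
def arcCap (a : ι → ℝ≥0∞) (b : κ → ℝ≥0∞) : Node ι κ × Node ι κ → ℝ≥0∞
  | (Node.source, Node.inner (Sum.inl g)) => a g
  | (Node.inner (Sum.inr j), Node.sink) => b j
  | _ => ⊤

/-- The network `(V, E, s, t)`: the arcs of `G` with infinite capacity, an arc `(s, g)` of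
capacity `a g` for every group vertex `g`, and an arc `(j, t)` of capacity `b j` for every
variable vertex `j`. -/
def network (G : GroupGraph ι κ) (a : ι → ℝ≥0∞) (b : κ → ℝ≥0∞) : FlowNetwork (Node ι κ) where
  verts := {Node.source, Node.sink} ∪ G.verts.image Node.inner
  arcs := G.groups.image (fun g => (Node.source, Node.inner (Sum.inl g)))
    ∪ G.arcs.image (fun e => (Node.inner e.1, Node.inner e.2))
    ∪ G.vars.image (fun j => (Node.inner (Sum.inr j), Node.sink))
  source := Node.source
  sink := Node.sink
  cap := arcCap a b
  source_mem := by simp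
  sink_mem := by simp
  source_ne_sink := by simp
  arcs_mem := by
    intro e he
    simp only [Finset.mem_union, Finset.mem_image] at he
    rcases he with (⟨g, hg, rfl⟩ | ⟨e', he', rfl⟩) | ⟨j, hj, rfl⟩
    · simpa [groups] using hg
    · simpa using G.arcs_mem e' he'
    · simpa [vars] using hj

/-- `l` is the list of vertices of a directed path from `x` to `y` (no vertex is repeated). -/
def IsPath (G : GroupGraph ι κ) (x y : ι ⊕ κ) (l : List (ι ⊕ κ)) : Prop :=
  l.head? = some x ∧ l.getLast? = some y ∧ l.IsChain (fun v w => (v, w) ∈ G.arcs) ∧ l.Nodup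

/-- The canonical graph of a group structure: one vertex for every group and every variable, and
an arc `(g, j)` whenever `j ∈ g`. -/
def canonical [Fintype ι] [Fintype κ] (grp : ι → Finset κ) : GroupGraph ι κ where
  verts := Finset.univ
  arcs := Finset.univ.filter fun e => ∃ g, ∃ j ∈ grp g, e = (Sum.inl g, Sum.inr j)
  arcs_mem := by simp

/-- `G` is equivalent to the graph `C`: the vertices are the same, for every arc `(g, j)` of `C`
from a group to a variable `G` has exactly one path from `g` to `j`, and there is such an arc in
`C` whenever `G` has a path from `g` to `j`. The arcs at the source and at the sink are the same
by construction, and all other arcs have zero cost and infinite capacity. -/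
structure IsEquivalent (G C : GroupGraph ι κ) : Prop where
  verts_eq : G.verts = C.verts
  unique_path : ∀ g j, (Sum.inl g, Sum.inr j) ∈ C.arcs → ∃! l, G.IsPath (Sum.inl g) (Sum.inr j) l
  arc_of_path : ∀ g j l, G.IsPath (Sum.inl g) (Sum.inr j) l → (Sum.inl g, Sum.inr j) ∈ C.arcs

end GroupGraph

/-! ### The procedure `computeFlow` -/

section Algorithm

variable {ι κ : Type*} [DecidableEq ι] [DecidableEq κ]

/-- The flow that `f` carries on the arcs `(j, t)`. -/
def sinkFlow (f : Node ι κ × Node ι κ → ℝ) (j : κ) : ℝ :=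
  f (Node.inner (Sum.inr j), Node.sink)

/-- The projection step: `γ` is the orthogonal projection of `(u_j)_{j ∈ V_u}` on the `ℓ₁`-ball of
radius `lam * ∑_{g ∈ V_gr} η_g` (entries of `γ` outside `V_u` play no role). -/
def IsProjection (u : κ → ℝ) (η : ι → ℝ) (lam : ℝ) (G : GroupGraph ι κ) (γ : κ → ℝ) : Prop :=
  ∑ j ∈ G.vars, |γ j| ≤ lam * ∑ g ∈ G.groups, η g ∧
  ∀ γ' : κ → ℝ, ∑ j ∈ G.vars, |γ' j| ≤ lam * ∑ g ∈ G.groups, η g →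
    ∑ j ∈ G.vars, 1 / 2 * (u j - γ j) ^ 2 ≤ ∑ j ∈ G.vars, 1 / 2 * (u j - γ' j) ^ 2

/-- The network of the max-flow step: capacity `lam * η_g` on `(s, g)` and `γ_j` on `(j, t)`. -/
def stepNetwork (η : ι → ℝ) (lam : ℝ) (G : GroupGraph ι κ) (γ : κ → ℝ) :
    FlowNetwork (Node ι κ) :=
  G.network (fun g => ENNReal.ofReal (lam * η g)) (fun j => ENNReal.ofReal (γ j))

/-- `γ` and `f` are admissible results of the projection step and of the max-flow step of
`computeFlow` on `G`. -/
def IsStep (u : κ → ℝ) (η : ι → ℝ) (lam : ℝ) (G : GroupGraph ι κ) (γ : κ → ℝ)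
    (f : Node ι κ × Node ι κ → ℝ) : Prop :=
  IsProjection u η lam G γ ∧ (stepNetwork η lam G γ).IsMaxFlow f

/-- The test of `computeFlow`: the max-flow does not reach `γ`, so that the graph is split. -/
def Mismatch (G : GroupGraph ι κ) (γ : κ → ℝ) (f : Node ι κ × Node ι κ → ℝ) : Prop :=
  ∃ j ∈ G.vars, sinkFlow f j ≠ γ j

/-- The part `(V⁺, E⁺)` of the graph on the source side of the cut `S`. -/
def plusPart (G : GroupGraph ι κ) (S : Finset (Node ι κ)) : GroupGraph ι κ :=
  G.induce fun x => Node.inner x ∈ S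

/-- The part `(V⁻, E⁻)` of the graph on the sink side of the cut `S`. -/
def minusPart (G : GroupGraph ι κ) (S : Finset (Node ι κ)) : GroupGraph ι κ :=
  G.induce fun x => Node.inner x ∉ S

/-- `ComputeFlow u η lam G ξ`: some execution of `computeFlow` on `G` returns `(ξ_j)_{j ∈ V_u}`.
Any maximum flow and any minimum cut may be used in each call. -/
inductive ComputeFlow (u : κ → ℝ) (η : ι → ℝ) (lam : ℝ) : GroupGraph ι κ → (κ → ℝ) → Prop
  | leaf (G : GroupGraph ι κ) (γ : κ → ℝ) (f : Node ι κ × Node ι κ → ℝ)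
      (hstep : IsStep u η lam G γ f) (heq : ¬ Mismatch G γ f) :
      ComputeFlow u η lam G (sinkFlow f)
  | split (G : GroupGraph ι κ) (γ : κ → ℝ) (f : Node ι κ × Node ι κ → ℝ)
      (S : Finset (Node ι κ)) (ξplus ξminus : κ → ℝ)
      (hstep : IsStep u η lam G γ f) (hne : Mismatch G γ f)
      (hcut : (stepNetwork η lam G γ).IsMinCut S)
      (hplus : ComputeFlow u η lam (plusPart G S) ξplus)
      (hminus : ComputeFlow u η lam (minusPart G S) ξminus) :
      ComputeFlow u η lam G
        (fun j => if j ∈ (plusPart G S).vars then ξplus j else ξminus j)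

/-- Every execution of `computeFlow` on `G` ends after finitely many calls and never gets stuck:
each step can be carried out, and for every choice of its results the recursive calls end. -/
inductive Halts (u : κ → ℝ) (η : ι → ℝ) (lam : ℝ) : GroupGraph ι κ → Prop
  | intro (G : GroupGraph ι κ)
      (hproj : ∃ γ, IsProjection u η lam G γ)
      (hflow : ∀ γ, IsProjection u η lam G γ → ∃ f, (stepNetwork η lam G γ).IsMaxFlow f)
      (hcut : ∀ γ f, IsStep u η lam G γ f → Mismatch G γ f →
        ∃ S, (stepNetwork η lam G γ).IsMinCut S)
      (hplus : ∀ γ f S, IsStep u η lam G γ f → Mismatch G γ f →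
        (stepNetwork η lam G γ).IsMinCut S → Halts u η lam (plusPart G S))
      (hminus : ∀ γ f S, IsStep u η lam G γ f → Mismatch G γ f →
        (stepNetwork η lam G γ).IsMinCut S → Halts u η lam (minusPart G S)) :
      Halts u η lam G

/-! ### The quadratic min-cost flow problem -/

/-- The network of the min-cost flow problem: capacity `lam * η_g` on `(s, g)` and infinite
capacity on every other arc. -/
def costNetwork (η : ι → ℝ) (lam : ℝ) (G : GroupGraph ι κ) : FlowNetwork (Node ι κ) :=
  G.network (fun g => ENNReal.ofReal (lam * η g)) (fun _ => ⊤)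

/-- The cost of a flow: `(u_j - ξ_j)² / 2` on each arc `(j, t)` and zero on every other arc. -/
def flowCost (u : κ → ℝ) (G : GroupGraph ι κ) (f : Node ι κ × Node ι κ → ℝ) : ℝ :=
  ∑ j ∈ G.vars, 1 / 2 * (u j - sinkFlow f j) ^ 2

/-- `f` solves the quadratic min-cost flow problem on `G`. -/
def IsMinCostFlow (u : κ → ℝ) (η : ι → ℝ) (lam : ℝ) (G : GroupGraph ι κ)
    (f : Node ι κ × Node ι κ → ℝ) : Prop :=
  (costNetwork η lam G).IsFlow f ∧
    ∀ f', (costNetwork η lam G).IsFlow f' → flowCost u G f ≤ flowCost u G f'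

end Algorithm

/-! ### The proximal problem and the complete algorithm -/

section Prox

variable {ι : Type*} [Fintype ι] {p : ℕ}

/-- `Ω(w) = ∑_g η_g max_{j ∈ g} |w_j|`. -/
def omega (grp : ι → Finset (Fin p)) (η : ι → ℝ) (w : EuclideanSpace ℝ (Fin p)) : ℝ :=
  ∑ g, η g * ((grp g).sup (fun j => ‖w j‖₊) : ℝ≥0)

/-- The objective `½ ‖u - w‖₂² + lam * Ω(w)` of the proximal problem. -/
def proxObjective (grp : ι → Finset (Fin p)) (η : ι → ℝ) (lam : ℝ)
    (u w : EuclideanSpace ℝ (Fin p)) : ℝ :=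
  1 / 2 * ‖u - w‖ ^ 2 + lam * omega grp η w

/-- The vector that the algorithm returns: `u_j - ξ_j` where `u_j ≥ 0`, and `u_j + ξ_j` where the
sign of `u_j < 0` had been flipped. -/
def output (u : EuclideanSpace ℝ (Fin p)) (ξ : Fin p → ℝ) : EuclideanSpace ℝ (Fin p) :=
  WithLp.toLp 2 fun j => if 0 ≤ u j then u j - ξ j else u j + ξ j

end Prox

end ProxFlow

end

set_option linter.unusedSectionVars false

/-! The proof rests on an optimality certificate (`IsCertificate`): a flow with sink values `ξ` and
a non-negative potential `π` on the inner vertices. The potential does not increase along arcs, is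
constant along arcs that carry flow, and vanishes at groups whose source arc is not full. At a
variable it dominates the residual `u j - ξ j`, with equality where `ξ j ≠ 0`. These are the KKT
conditions, so a certificate gives minimal cost.

Every output of the recursion has a certificate. At a leaf, `γ` is the soft threshold of `u` at some
level `τ`, and the constant potential `τ` works. At a split, complementary slackness of maximum flow
and minimum cut shows that no arc leaves `V⁺`, that the sink arcs of `V⁺` are full, and that the
source arcs of `V⁻` are full. Comparing the restricted flow with the recursive solutions on level
sets of their potentials gives residuals at most `τ` on `V⁺`, and at least `τ` on `V⁻` wherever `ξ`
is nonzero (`residual_le_of_threshold`, `threshold_le_residual`). Hence the potentials may be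
truncated at `τ` from above and from below; the truncated certificates fit together because the
remaining arcs run from `V⁻` to `V⁺`. A mismatch makes both parts strictly smaller
(`card_parts_lt`), so the recursion ends.

For the proximal problem, paths link flows to `Ω`: every `v` satisfies `∑ ξ j * |v j| ≤ lam * Ω(v)`,
and the potential gives the reverse inequality at the output `w`. So `u - w` is a subgradient of
`lam * Ω` at `w`, and strong convexity makes `w` the unique minimizer. -/

namespace ProxFlow

/-! ### Max-flow min-cut with possibly infinite capacities -/

namespace FlowNetwork

open Filter Topology

variable {N : Type*} [DecidableEq N] {K : FlowNetwork N} {f : N × N → ℝ} {S : Finset N}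

theorem outflow_sub_inflow (K : FlowNetwork N) (f : N × N → ℝ) (v : N) :
    K.outflow f v - K.inflow f v =
      ∑ e ∈ K.arcs, f e * ((if e.1 = v then 1 else 0) - if e.2 = v then 1 else 0) := by
  simp [outflow, inflow, Finset.sum_filter, mul_sub, Finset.sum_sub_distrib]

theorem sum_mul_sub_eq_sum_verts (K : FlowNetwork N) (f : N × N → ℝ) (φ : N → ℝ) :
    ∑ e ∈ K.arcs, f e * (φ e.1 - φ e.2) =
      ∑ v ∈ K.verts, φ v * (K.outflow f v - K.inflow f v) := by
  simp only [outflow_sub_inflow, Finset.mul_sum]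
  rw [Finset.sum_comm]
  refine Finset.sum_congr rfl fun e he => ?_
  have h := K.arcs_mem e he
  have h1 (v : N) : φ v * (f e * ((if e.1 = v then 1 else 0) - if e.2 = v then 1 else 0)) =
      (if e.1 = v then φ v * f e else 0) - if e.2 = v then φ v * f e else 0 := by
    split_ifs <;> ring
  simp only [h1, Finset.sum_sub_distrib, Finset.sum_ite_eq, h.1, h.2, if_true]
  ring

/-- Summation by parts: a flow paired with the differences of a potential. -/
theorem IsFlow.sum_mul_sub (hf : K.IsFlow f) (φ : N → ℝ) :
    ∑ e ∈ K.arcs, f e * (φ e.1 - φ e.2) = K.value f * (φ K.source - φ K.sink) := by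
  have key (φ : N → ℝ) : ∑ e ∈ K.arcs, f e * (φ e.1 - φ e.2) =
      φ K.source * K.value f + φ K.sink * (K.outflow f K.sink - K.inflow f K.sink) := by
    rw [sum_mul_sub_eq_sum_verts, ← Finset.sum_subset (s₁ := {K.source, K.sink}),
      Finset.sum_pair K.source_ne_sink, value]
    · simp [Finset.insert_subset_iff, K.source_mem, K.sink_mem]
    · intro v hv h
      simp only [Finset.mem_insert, Finset.mem_singleton, not_or] at h
      rw [hf.conserved v hv h.1 h.2, sub_self, mul_zero]
  -- The constant potential shows that the net outflows of source and sink cancel.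
  have h1 := key fun _ => 1
  simp only [sub_self, mul_zero, Finset.sum_const_zero, one_mul] at h1
  rw [key]
  linear_combination -φ K.sink * h1

theorem IsFlow.value_eq (hf : K.IsFlow f) (hS : K.IsCut S) :
    K.value f = (∑ e ∈ K.arcs with e.1 ∈ S ∧ e.2 ∉ S, f e)
      - ∑ e ∈ K.arcs with e.1 ∉ S ∧ e.2 ∈ S, f e := by
  have h := hf.sum_mul_sub fun v => if v ∈ S then 1 else 0
  simp only [hS.2.1, hS.2.2, if_true, if_false, sub_zero, mul_one] at h
  rw [← h, Finset.sum_filter, Finset.sum_filter, ← Finset.sum_sub_distrib]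
  refine Finset.sum_congr rfl fun e _ => ?_
  by_cases h1 : e.1 ∈ S <;> by_cases h2 : e.2 ∈ S <;> simp [h1, h2]

theorem IsFlow.ofReal_sum_le_cutCapacity (hf : K.IsFlow f) (S : Finset N) :
    ENNReal.ofReal (∑ e ∈ K.arcs with e.1 ∈ S ∧ e.2 ∉ S, f e) ≤ K.cutCapacity S := by
  rw [ENNReal.ofReal_sum_of_nonneg fun e he => hf.nonneg e (Finset.mem_filter.1 he).1]
  exact Finset.sum_le_sum fun e he => hf.le_cap e (Finset.mem_filter.1 he).1

theorem IsFlow.value_le_sum (hf : K.IsFlow f) (hS : K.IsCut S) :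
    K.value f ≤ ∑ e ∈ K.arcs with e.1 ∈ S ∧ e.2 ∉ S, f e := by
  rw [hf.value_eq hS]
  exact sub_le_self _ (Finset.sum_nonneg fun e he => hf.nonneg e (Finset.mem_filter.1 he).1)

theorem IsFlow.ofReal_value_le (hf : K.IsFlow f) (hS : K.IsCut S) :
    ENNReal.ofReal (K.value f) ≤ K.cutCapacity S :=
  (ENNReal.ofReal_le_ofReal (hf.value_le_sum hS)).trans (hf.ofReal_sum_le_cutCapacity S)

/-- The flow `f` fills all arcs that leave `S` and does not use the arcs that enter `S`. -/
def Saturates (K : FlowNetwork N) (f : N × N → ℝ) (S : Finset N) : Prop :=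
  ∀ e ∈ K.arcs, (e.1 ∈ S → e.2 ∉ S → ENNReal.ofReal (f e) = K.cap e) ∧
    (e.1 ∉ S → e.2 ∈ S → f e = 0)

theorem Saturates.value_eq (h : K.Saturates f S) (hf : K.IsFlow f) (hS : K.IsCut S) :
    K.value f = ∑ e ∈ K.arcs with e.1 ∈ S ∧ e.2 ∉ S, f e := by
  rw [hf.value_eq hS, sub_eq_self]
  refine Finset.sum_eq_zero fun e he => ?_
  rw [Finset.mem_filter] at he
  exact (h e he.1).2 he.2.1 he.2.2

theorem Saturates.value_nonneg (h : K.Saturates f S) (hf : K.IsFlow f) (hS : K.IsCut S) :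
    0 ≤ K.value f := by
  rw [h.value_eq hf hS]
  exact Finset.sum_nonneg fun e he => hf.nonneg e (Finset.mem_filter.1 he).1

theorem Saturates.cutCapacity_eq (h : K.Saturates f S) (hf : K.IsFlow f) (hS : K.IsCut S) :
    K.cutCapacity S = ENNReal.ofReal (K.value f) := by
  rw [h.value_eq hf hS,
    ENNReal.ofReal_sum_of_nonneg fun e he => hf.nonneg e (Finset.mem_filter.1 he).1]
  refine Finset.sum_congr rfl fun e he => ?_
  rw [Finset.mem_filter] at he
  exact ((h e he.1).1 he.2.1 he.2.2).symm

/-- Equality in weak duality: the capacity of the saturated cut bounds the value of every flow. -/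
theorem Saturates.isMaxFlow (h : K.Saturates f S) (hf : K.IsFlow f) (hS : K.IsCut S) :
    K.IsMaxFlow f := by
  refine ⟨hf, fun f' hf' => ?_⟩
  have h1 := hf'.ofReal_value_le hS
  rw [h.cutCapacity_eq hf hS] at h1
  exact (ENNReal.ofReal_le_ofReal_iff (h.value_nonneg hf hS)).1 h1

/-- The arcs of the residual graph of `f`. -/
def Residual (K : FlowNetwork N) (f : N × N → ℝ) (x y : N) : Prop :=
  ((x, y) ∈ K.arcs ∧ ENNReal.ofReal (f (x, y)) ≠ K.cap (x, y)) ∨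
    ((y, x) ∈ K.arcs ∧ f (y, x) ≠ 0)

/-- A direction in which `f` can be changed without violating the bounds on the arcs. -/
def IsFeasibleDirection (K : FlowNetwork N) (f d : N × N → ℝ) : Prop :=
  ∀ e ∈ K.arcs, (f e = 0 → 0 ≤ d e) ∧ (ENNReal.ofReal (f e) = K.cap e → d e ≤ 0)

/-- A unit of flow is pushed along a residual walk. Recording its divergence by pairing with
potentials lets the walk revisit vertices and arcs. -/
theorem exists_isFeasibleDirection {x y : N} (h : Relation.ReflTransGen (K.Residual f) x y) :
    ∃ d, K.IsFeasibleDirection f d ∧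
      ∀ φ : N → ℝ, ∑ e ∈ K.arcs, d e * (φ e.1 - φ e.2) = φ x - φ y := by
  induction h with
  | refl => exact ⟨0, fun e _ => by simp, fun φ => by simp⟩
  | @tail y z _ hyz ih =>
    obtain ⟨d, hd, hφ⟩ := ih
    rcases hyz with ⟨he, hne⟩ | ⟨he, hne⟩
    · refine ⟨fun e => d e + if e = (y, z) then 1 else 0, fun e hem => ?_, fun φ => ?_⟩
      · have := hd e hem
        rcases eq_or_ne e (y, z) with rfl | h
        · simp only [if_true, hne, false_imp_iff, and_true]
          intro h0
          linarith [this.1 h0]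
        · simpa [h] using this
      · simp only [add_mul, Finset.sum_add_distrib, hφ, ite_mul, zero_mul, one_mul,
          Finset.sum_ite_eq', he, if_true]
        ring
    · refine ⟨fun e => d e - if e = (z, y) then 1 else 0, fun e hem => ?_, fun φ => ?_⟩
      · have := hd e hem
        rcases eq_or_ne e (z, y) with rfl | h
        · simp only [if_true, hne, false_imp_iff, true_and]
          intro h0
          linarith [this.2 h0]
        · simpa [h] using this
      · simp only [sub_mul, Finset.sum_sub_distrib, hφ, ite_mul, zero_mul, one_mul,
          Finset.sum_ite_eq', he, if_true]
        ring

/-- On each of the finitely many arcs, a tight bound is respected by the sign of `d`, and a slack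
bound survives small steps by continuity. -/
theorem IsFeasibleDirection.eventually {d : N × N → ℝ} (hd : K.IsFeasibleDirection f d)
    (hf : K.IsFlow f) : ∀ᶠ ε in 𝓝[>] (0 : ℝ), ∀ e ∈ K.arcs,
      0 ≤ f e + ε * d e ∧ ENNReal.ofReal (f e + ε * d e) ≤ K.cap e := by
  rw [Filter.eventually_all_finset]
  intro e he
  have hcont : Continuous fun ε : ℝ => f e + ε * d e := by fun_prop
  have hlim : Tendsto (fun ε : ℝ => f e + ε * d e) (𝓝[>] 0) (𝓝 (f e)) := by
    have := hcont.tendsto 0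
    simp only [zero_mul, add_zero] at this
    exact this.mono_left nhdsWithin_le_nhds
  have hpos : ∀ᶠ ε in 𝓝[>] (0 : ℝ), 0 < ε := self_mem_nhdsWithin
  refine Filter.Eventually.and ?_ ?_
  · rcases (hf.nonneg e he).eq_or_lt with h | h
    · filter_upwards [hpos] with ε hε
      rw [← h, zero_add]
      exact mul_nonneg hε.le ((hd e he).1 h.symm)
    · filter_upwards [hlim.eventually_const_lt h] with ε hε using hε.le
  · rcases (hf.le_cap e he).eq_or_lt with h | h
    · filter_upwards [hpos] with ε hε
      rw [← h]
      refine ENNReal.ofReal_le_ofReal ?_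
      have := mul_nonpos_of_nonneg_of_nonpos hε.le ((hd e he).2 h)
      linarith
    · filter_upwards [((ENNReal.continuous_ofReal.tendsto _).comp hlim).eventually_lt_const h]
        with ε hε using hε.le

theorem IsMaxFlow.not_reflTransGen_residual (hf : K.IsMaxFlow f) :
    ¬ Relation.ReflTransGen (K.Residual f) K.source K.sink := by
  intro h
  obtain ⟨d, hd, hφ⟩ := exists_isFeasibleDirection h
  obtain ⟨ε, hε, hpos⟩ := ((hd.eventually hf.1).and self_mem_nhdsWithin).exists
  have hpos : 0 < ε := hpos
  have hdiv (v : N) : K.outflow (fun e => f e + ε * d e) v - K.inflow (fun e => f e + ε * d e) v =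
      K.outflow f v - K.inflow f v
        + ε * ((if K.source = v then 1 else 0) - if K.sink = v then 1 else 0) := by
    rw [← hφ fun w => if w = v then 1 else 0, outflow_sub_inflow, outflow_sub_inflow,
      Finset.mul_sum, ← Finset.sum_add_distrib]
    exact Finset.sum_congr rfl fun e _ => by ring
  have hflow : K.IsFlow fun e => f e + ε * d e := by
    refine ⟨fun e he => (hε e he).1, fun e he => (hε e he).2, fun v hv hs ht => ?_⟩
    have := hdiv v
    rw [hf.1.conserved v hv hs ht, if_neg hs.symm, if_neg ht.symm] at this
    linarith
  have h1 := hf.2 _ hflow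
  have h2 := hdiv K.source
  rw [if_pos rfl, if_neg K.source_ne_sink.symm] at h2
  simp only [value] at h1
  linarith

theorem IsMaxFlow.exists_saturates (hf : K.IsMaxFlow f) : ∃ S, K.IsCut S ∧ K.Saturates f S := by
  classical
  -- No residual arc leaves the set of vertices reachable from the source, which is exactly
  -- saturation.
  refine ⟨{v ∈ K.verts | Relation.ReflTransGen (K.Residual f) K.source v}, ⟨?_, ?_, ?_⟩, ?_⟩
  · exact Finset.filter_subset _ _
  · exact Finset.mem_filter.2 ⟨K.source_mem, .refl⟩
  · simp [hf.not_reflTransGen_residual]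
  · intro e he
    have hv := K.arcs_mem e he
    simp only [Finset.mem_filter, hv.1, hv.2, true_and]
    refine ⟨fun h1 h2 => ?_, fun h1 h2 => ?_⟩
    · by_contra h
      exact h2 (h1.tail (Or.inl ⟨he, h⟩))
    · by_contra h
      exact h1 (h2.tail (Or.inr ⟨he, h⟩))

/-- Complementary slackness for a maximum flow and a minimum cut. -/
theorem IsMaxFlow.saturates (hf : K.IsMaxFlow f) (hS : K.IsMinCut S) : K.Saturates f S := by
  -- The saturated cut `S₀` need not be `S`, but by minimality it bounds the capacity of `S` by the
  -- value of `f`. All inequalities of weak duality for `S` are then equalities.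
  obtain ⟨S₀, hS₀, hsat⟩ := hf.exists_saturates
  have hcap : K.cutCapacity S ≤ ENNReal.ofReal (K.value f) :=
    (hS.2 S₀ hS₀).trans (hsat.cutCapacity_eq hf.1 hS₀).le
  have hsum := hf.1.ofReal_sum_le_cutCapacity S
  have hle : ∑ e ∈ K.arcs with e.1 ∈ S ∧ e.2 ∉ S, f e ≤ K.value f :=
    (ENNReal.ofReal_le_ofReal_iff (hsat.value_nonneg hf.1 hS₀)).1 (hsum.trans hcap)
  have hin : ∑ e ∈ K.arcs with e.1 ∉ S ∧ e.2 ∈ S, f e ≤ 0 := by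
    linarith [hf.1.value_eq hS.1]
  have hnn : ∀ e ∈ K.arcs.filter (fun e => e.1 ∉ S ∧ e.2 ∈ S), 0 ≤ f e :=
    fun e he => hf.1.nonneg e (Finset.mem_filter.1 he).1
  have hzero := (Finset.sum_eq_zero_iff_of_nonneg hnn).1 (le_antisymm hin (Finset.sum_nonneg hnn))
  refine fun e he => ⟨fun h1 h2 => ?_, fun h1 h2 => hzero e (Finset.mem_filter.2 ⟨he, h1, h2⟩)⟩
  refine le_antisymm (hf.1.le_cap e he) (not_lt.1 fun hlt => ?_)
  have hmem : e ∈ K.arcs.filter (fun e => e.1 ∈ S ∧ e.2 ∉ S) := Finset.mem_filter.2 ⟨he, h1, h2⟩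
  have hstrict : ENNReal.ofReal (∑ e ∈ K.arcs with e.1 ∈ S ∧ e.2 ∉ S, f e) < K.cutCapacity S := by
    rw [ENNReal.ofReal_sum_of_nonneg fun e he => hf.1.nonneg e (Finset.mem_filter.1 he).1]
    unfold cutCapacity
    rw [← Finset.add_sum_erase _ _ hmem, ← Finset.add_sum_erase _ (fun e => K.cap e) hmem]
    refine ENNReal.add_lt_add_of_lt_of_le ?_ hlt ?_
    · exact ENNReal.sum_ne_top.2 fun _ _ => ENNReal.ofReal_ne_top
    · exact Finset.sum_le_sum fun e he =>
        hf.1.le_cap e (Finset.mem_filter.1 (Finset.mem_of_mem_erase he)).1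
  have := hstrict.trans_le hcap
  exact this.not_ge (ENNReal.ofReal_le_ofReal (hf.1.value_le_sum hS.1))

theorem exists_isMinCut (K : FlowNetwork N) : ∃ S, K.IsMinCut S := by
  classical
  obtain ⟨S, hS, hmin⟩ := Finset.exists_min_image {S ∈ K.verts.powerset | K.IsCut S}
    K.cutCapacity ⟨{K.source}, Finset.mem_filter.2 ⟨by simp [K.source_mem],
      by simp [K.source_mem], by simp, by simp [K.source_ne_sink.symm]⟩⟩
  exact ⟨S, (Finset.mem_filter.1 hS).2, fun S' hS' =>
    hmin S' (Finset.mem_filter.2 ⟨Finset.mem_powerset.2 hS'.1, hS'⟩)⟩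

theorem exists_isMaxFlow_of_cap_ne_top (hK : ∀ e ∈ K.arcs, K.cap e ≠ ⊤) :
    ∃ f, K.IsMaxFlow f := by
  let B : Set (N × N → ℝ) :=
    Set.univ.pi fun e => Set.Icc 0 (if e ∈ K.arcs then (K.cap e).toReal else 0)
  have hB : IsCompact B := isCompact_univ_pi fun _ => isCompact_Icc
  have hin (v : N) : Continuous fun f => K.inflow f v := by unfold inflow; fun_prop
  have hout (v : N) : Continuous fun f => K.outflow f v := by unfold outflow; fun_prop
  have hC : IsClosed {f | ∀ v ∈ K.verts, v ≠ K.source → v ≠ K.sink →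
      K.inflow f v = K.outflow f v} := by
    simp only [Set.ofPred_forall]
    exact isClosed_iInter fun v => isClosed_iInter fun _ => isClosed_iInter fun _ =>
      isClosed_iInter fun _ => isClosed_eq (hin v) (hout v)
  obtain ⟨f, hf, hmax⟩ := (hB.inter_right hC).exists_isMaxOn (f := K.value)
    ⟨0, fun e _ => by simp only [Set.mem_Icc, Pi.zero_apply, le_refl, true_and]; split_ifs <;> simp,
      fun v _ _ _ => by simp [inflow, outflow]⟩
    ((hout _).sub (hin _)).continuousOn
  refine ⟨f, ⟨fun e he => (hf.1 e trivial).1, fun e he => ?_, hf.2⟩, fun f' hf' => ?_⟩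
  · have := (hf.1 e trivial).2
    rw [if_pos he] at this
    exact ENNReal.ofReal_le_of_le_toReal this
  -- The compact box forces the value zero off the arcs, so a competitor is first cut off there.
  · let f'' : N × N → ℝ := fun e => if e ∈ K.arcs then f' e else 0
    have h1 (v : N) : K.inflow f'' v = K.inflow f' v :=
      Finset.sum_congr rfl fun e he => if_pos (Finset.mem_filter.1 he).1
    have h2 (v : N) : K.outflow f'' v = K.outflow f' v :=
      Finset.sum_congr rfl fun e he => if_pos (Finset.mem_filter.1 he).1
    have hmem : f'' ∈ B ∩ {f | ∀ v ∈ K.verts, v ≠ K.source → v ≠ K.sink →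
        K.inflow f v = K.outflow f v} := by
      refine ⟨fun e _ => ?_, fun v hv hs ht => by rw [h1, h2, hf'.conserved v hv hs ht]⟩
      by_cases he : e ∈ K.arcs
      · simp only [f'', he, if_true]
        exact ⟨hf'.nonneg e he, (ENNReal.ofReal_le_iff_le_toReal (hK e he)).1 (hf'.le_cap e he)⟩
      · simp [f'', he]
    have := hmax hmem
    simpa [value, h1, h2] using this

/-- The network with all capacities truncated at `M`. -/
def truncate (K : FlowNetwork N) (M : ℝ≥0∞) : FlowNetwork N where
  __ := K
  cap e := min (K.cap e) M

/-- Truncation above the capacity of a finite cut is harmless: in a maximum flow of the truncated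
network, arcs leaving a saturated cut carry at most the flow value, which is below the truncation
level. They are therefore full for the original capacities as well. -/
theorem exists_isMaxFlow (hS : K.IsCut S) (hcap : K.cutCapacity S ≠ ⊤) :
    ∃ f, K.IsMaxFlow f := by
  have hM : K.cutCapacity S + 1 ≠ ⊤ := by simp [hcap]
  let K' := K.truncate (K.cutCapacity S + 1)
  obtain ⟨f, hf⟩ : ∃ f, K'.IsMaxFlow f := exists_isMaxFlow_of_cap_ne_top fun e _ =>
    ne_top_of_le_ne_top hM (min_le_right _ _)
  obtain ⟨S₀, hS₀, hsat⟩ := hf.exists_saturates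
  have hflow : K.IsFlow f :=
    ⟨hf.1.nonneg, fun e he => (hf.1.le_cap e he).trans (min_le_left _ _), hf.1.conserved⟩
  refine ⟨f, Saturates.isMaxFlow (S := S₀) ?_ hflow hS₀⟩
  refine fun e he => ⟨fun h1 h2 => ?_, (hsat e he).2⟩
  have h := (hsat e he).1 h1 h2
  have hval : f e ≤ K'.value f := by
    rw [hsat.value_eq hf.1 hS₀]
    exact Finset.single_le_sum (f := f)
      (fun e he => hf.1.nonneg e (Finset.mem_filter.1 he).1) (Finset.mem_filter.2 ⟨he, h1, h2⟩)
  have hlt : ENNReal.ofReal (f e) < K.cutCapacity S + 1 :=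
    calc ENNReal.ofReal (f e) ≤ ENNReal.ofReal (K.value f) := ENNReal.ofReal_le_ofReal hval
      _ ≤ K.cutCapacity S := hflow.ofReal_value_le hS
      _ < K.cutCapacity S + 1 := ENNReal.lt_add_right hcap one_ne_zero
  rcases min_choice (K.cap e) (K.cutCapacity S + 1) with h' | h'
  · exact h.trans h'
  · exact absurd (h.trans h') hlt.ne

end FlowNetwork

/-! ### Balanced flows and paths in group graphs -/

namespace GroupGraph

variable {ι κ : Type*} [DecidableEq ι] [DecidableEq κ] {G : GroupGraph ι κ}

theorem mem_groups {g : ι} : g ∈ G.groups ↔ Sum.inl g ∈ G.verts := by simp [groups]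

theorem mem_vars {j : κ} : j ∈ G.vars ↔ Sum.inr j ∈ G.verts := by simp [vars]

section Induce

variable (P : ι ⊕ κ → Prop) [DecidablePred P]

theorem groups_induce : (G.induce P).groups = {g ∈ G.groups | P (Sum.inl g)} := by
  ext g; simp [groups, induce]

theorem vars_induce : (G.induce P).vars = {j ∈ G.vars | P (Sum.inr j)} := by
  ext g; simp [vars, induce]

theorem arcs_induce : (G.induce P).arcs = {e ∈ G.arcs | P e.1 ∧ P e.2} := rfl

end Induce

theorem sum_network_arcs (G : GroupGraph ι κ) (a : ι → ℝ≥0∞) (b : κ → ℝ≥0∞)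
    (F : Node ι κ × Node ι κ → ℝ) :
    ∑ e ∈ (G.network a b).arcs, F e =
      ∑ g ∈ G.groups, F (Node.source, Node.inner (Sum.inl g))
        + ∑ e ∈ G.arcs, F (Node.inner e.1, Node.inner e.2)
        + ∑ j ∈ G.vars, F (Node.inner (Sum.inr j), Node.sink) := by
  unfold network
  rw [Finset.sum_union, Finset.sum_union, Finset.sum_image, Finset.sum_image, Finset.sum_image]
  · intro i _ j _ h; simpa using h
  · rintro ⟨i, i'⟩ _ ⟨j, j'⟩ _ h; simpa using h
  · intro i _ j _ h; simpa using h
  · rw [Finset.disjoint_left]; simp only [Finset.mem_image]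
    rintro _ ⟨g, _, rfl⟩ ⟨e, _, h⟩; simp at h
  · rw [Finset.disjoint_left]; simp only [Finset.mem_union, Finset.mem_image]
    rintro _ (⟨g, _, rfl⟩ | ⟨e, _, rfl⟩) ⟨j, _, h⟩ <;> simp at h

theorem forall_network_arcs (G : GroupGraph ι κ) (a : ι → ℝ≥0∞) (b : κ → ℝ≥0∞)
    {P : Node ι κ × Node ι κ → Prop} :
    (∀ e ∈ (G.network a b).arcs, P e) ↔
      (∀ g ∈ G.groups, P (Node.source, Node.inner (Sum.inl g))) ∧
      (∀ e ∈ G.arcs, P (Node.inner e.1, Node.inner e.2)) ∧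
      ∀ j ∈ G.vars, P (Node.inner (Sum.inr j), Node.sink) := by
  simp only [network, Finset.mem_union, or_imp, forall_and, Finset.forall_mem_image, and_assoc]

/-- Flow conservation, in weak form: `a`, `x` and `z` are the amounts on the arcs from the source,
on the inner arcs and on the arcs to the sink. -/
def IsBalanced (G : GroupGraph ι κ) (a : ι → ℝ) (x : (ι ⊕ κ) × (ι ⊕ κ) → ℝ) (z : κ → ℝ) : Prop :=
  ∀ φ : ι ⊕ κ → ℝ,
    ∑ j ∈ G.vars, z j * φ (Sum.inr j) + ∑ e ∈ G.arcs, x e * (φ e.1 - φ e.2) =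
      ∑ g ∈ G.groups, a g * φ (Sum.inl g)

theorem isBalanced_of_isFlow {a : ι → ℝ≥0∞} {b : κ → ℝ≥0∞} {f : Node ι κ × Node ι κ → ℝ}
    (hf : (G.network a b).IsFlow f) :
    G.IsBalanced (fun g => f (Node.source, Node.inner (Sum.inl g)))
      (fun e => f (Node.inner e.1, Node.inner e.2)) (sinkFlow f) := by
  intro φ
  have h := hf.sum_mul_sub fun v => match v with
    | Node.source => 0
    | Node.sink => 0
    | Node.inner x => φ x
  rw [sum_network_arcs] at h
  simp only [network, sub_self, mul_zero, zero_sub, sub_zero, mul_neg,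
    Finset.sum_neg_distrib] at h
  simp only [sinkFlow]
  linarith

/-- The function on the arcs of the network with prescribed values on the three kinds of arcs. -/
def assemble (a : ι → ℝ) (x : (ι ⊕ κ) × (ι ⊕ κ) → ℝ) (z : κ → ℝ) : Node ι κ × Node ι κ → ℝ
  | (Node.source, Node.inner (Sum.inl g)) => a g
  | (Node.inner (Sum.inr j), Node.sink) => z j
  | (Node.inner v, Node.inner w) => x (v, w)
  | _ => 0

theorem assemble_inner (a : ι → ℝ) (x : (ι ⊕ κ) × (ι ⊕ κ) → ℝ) (z : κ → ℝ) (v w : ι ⊕ κ) :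
    assemble a x z (Node.inner v, Node.inner w) = x (v, w) := by
  cases v <;> rfl

theorem arcCap_inner (a : ι → ℝ≥0∞) (b : κ → ℝ≥0∞) (v w : ι ⊕ κ) :
    arcCap a b (Node.inner v, Node.inner w) = ⊤ := by
  cases v <;> rfl

theorem IsBalanced.isFlow_assemble {a : ι → ℝ} {x : (ι ⊕ κ) × (ι ⊕ κ) → ℝ} {c : ι → ℝ}
    {z : κ → ℝ} (h : G.IsBalanced a x z) (ha : ∀ g ∈ G.groups, 0 ≤ a g)
    (hac : ∀ g ∈ G.groups, a g ≤ c g) (hx : ∀ e ∈ G.arcs, 0 ≤ x e) (hz : ∀ j ∈ G.vars, 0 ≤ z j) :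
    (G.network (fun g => ENNReal.ofReal (c g)) fun _ => ⊤).IsFlow (assemble a x z) := by
  refine ⟨?_, ?_, fun v hv hs ht => ?_⟩
  · rw [forall_network_arcs]
    exact ⟨ha, fun e he => (hx e he).trans_eq (assemble_inner ..).symm, hz⟩
  · rw [forall_network_arcs]
    exact ⟨fun g hg => ENNReal.ofReal_le_ofReal (hac g hg), fun e _ => le_top.trans_eq (arcCap_inner ..).symm,
      fun j _ => le_top⟩
  · rw [eq_comm, ← sub_eq_zero, FlowNetwork.outflow_sub_inflow, sum_network_arcs]
    rcases v with _ | _ | v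
    · exact absurd rfl hs
    · exact absurd rfl ht
    · have := h fun w => if w = v then 1 else 0
      simp only [assemble_inner, Node.inner.injEq, reduceCtorEq, if_false, zero_sub, sub_zero, mul_neg,
        Finset.sum_neg_distrib]
      simp only [assemble]
      linarith

section Induce

variable {P : ι ⊕ κ → Prop} [DecidablePred P] {a a' : ι → ℝ} {x x' : (ι ⊕ κ) × (ι ⊕ κ) → ℝ}
  {z z' : κ → ℝ}

theorem IsBalanced.induce (h : G.IsBalanced a x z)
    (hx : ∀ e ∈ G.arcs, x e ≠ 0 → (P e.1 ↔ P e.2)) : (G.induce P).IsBalanced a x z := by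
  intro φ
  have := h fun v => if P v then φ v else 0
  simp only [mul_ite, mul_zero] at this
  rw [vars_induce, groups_induce, arcs_induce, Finset.sum_filter, Finset.sum_filter,
    Finset.sum_filter, ← this]
  congr 1
  refine Finset.sum_congr rfl fun e he => ?_
  rcases eq_or_ne (x e) 0 with h0 | h0
  · simp [h0]
  · have := hx e he h0
    by_cases h2 : P e.2
    · simp [h2, this.2 h2]
    · simp [h2, mt this.1 h2]

theorem IsBalanced.merge (h : (G.induce P).IsBalanced a x z)
    (h' : (G.induce fun v => ¬ P v).IsBalanced a' x' z') :
    G.IsBalanced (fun g => if P (Sum.inl g) then a g else a' g)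
      (fun e => if P e.1 ∧ P e.2 then x e else if ¬ P e.1 ∧ ¬ P e.2 then x' e else 0)
      (fun j => if P (Sum.inr j) then z j else z' j) := by
  intro φ
  have h1 := h φ
  have h2 := h' φ
  rw [vars_induce, groups_induce, arcs_induce, Finset.sum_filter, Finset.sum_filter,
    Finset.sum_filter] at h1 h2
  have e1 : ∑ j ∈ G.vars, (if P (Sum.inr j) then z j else z' j) * φ (Sum.inr j) =
      ∑ j ∈ G.vars, (if P (Sum.inr j) then z j * φ (Sum.inr j) else 0) +
      ∑ j ∈ G.vars, (if ¬ P (Sum.inr j) then z' j * φ (Sum.inr j) else 0) := by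
    rw [← Finset.sum_add_distrib]
    refine Finset.sum_congr rfl fun j _ => ?_
    by_cases hj : P (Sum.inr j) <;> simp [hj]
  have e2 : ∑ g ∈ G.groups, (if P (Sum.inl g) then a g else a' g) * φ (Sum.inl g) =
      ∑ g ∈ G.groups, (if P (Sum.inl g) then a g * φ (Sum.inl g) else 0) +
      ∑ g ∈ G.groups, (if ¬ P (Sum.inl g) then a' g * φ (Sum.inl g) else 0) := by
    rw [← Finset.sum_add_distrib]
    refine Finset.sum_congr rfl fun g _ => ?_
    by_cases hg : P (Sum.inl g) <;> simp [hg]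
  have e3 : ∑ e ∈ G.arcs, (if P e.1 ∧ P e.2 then x e else
        if ¬ P e.1 ∧ ¬ P e.2 then x' e else 0) * (φ e.1 - φ e.2) =
      ∑ e ∈ G.arcs, (if P e.1 ∧ P e.2 then x e * (φ e.1 - φ e.2) else 0) +
      ∑ e ∈ G.arcs, (if ¬ P e.1 ∧ ¬ P e.2 then x' e * (φ e.1 - φ e.2) else 0) := by
    rw [← Finset.sum_add_distrib]
    refine Finset.sum_congr rfl fun e _ => ?_
    by_cases h1 : P e.1 <;> by_cases h2 : P e.2 <;> simp [h1, h2]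
  rw [e1, e2, e3]
  linarith

theorem IsBalanced.congr (h : G.IsBalanced a x z) (hz : ∀ j ∈ G.vars, z' j = z j) :
    G.IsBalanced a x z' := by
  intro φ
  rw [← h φ]
  congr 1
  exact Finset.sum_congr rfl fun j hj => by rw [hz j hj]

theorem IsBalanced.sum_eq (h : G.IsBalanced a x z) :
    ∑ j ∈ G.vars, z j = ∑ g ∈ G.groups, a g := by
  simpa using h fun _ => 1

/-- Weak duality: flow only moves towards lower potential, so it arrives at the variables with no
more than it received at the groups. -/
theorem IsBalanced.sum_mul_le {π : ι ⊕ κ → ℝ} {c : ι → ℝ} (h : G.IsBalanced a x z)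
    (hx : ∀ e ∈ G.arcs, 0 ≤ x e) (ha : ∀ g ∈ G.groups, a g ≤ c g)
    (hπ : ∀ e ∈ G.arcs, π e.2 ≤ π e.1) (hπ0 : ∀ g ∈ G.groups, 0 ≤ π (Sum.inl g)) :
    ∑ j ∈ G.vars, z j * π (Sum.inr j) ≤ ∑ g ∈ G.groups, c g * π (Sum.inl g) := by
  have h1 : 0 ≤ ∑ e ∈ G.arcs, x e * (π e.1 - π e.2) :=
    Finset.sum_nonneg fun e he => mul_nonneg (hx e he) (sub_nonneg.2 (hπ e he))
  have h2 : ∑ g ∈ G.groups, a g * π (Sum.inl g) ≤ ∑ g ∈ G.groups, c g * π (Sum.inl g) :=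
    Finset.sum_le_sum fun g hg => mul_le_mul_of_nonneg_right (ha g hg) (hπ0 g hg)
  linarith [h π]

end Induce

theorem le_of_isPath {π : ι ⊕ κ → ℝ} (hπ : ∀ e ∈ G.arcs, π e.2 ≤ π e.1) {x y : ι ⊕ κ}
    {l : List (ι ⊕ κ)} (h : G.IsPath x y l) : π y ≤ π x := by
  obtain ⟨h1, h2, h3, -⟩ := h
  induction l generalizing x with
  | nil => simp at h1
  | cons v l ih =>
    obtain rfl : v = x := by simpa using h1
    cases l with
    | nil =>
      obtain rfl : v = y := by simpa using h2
      exact le_rfl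
    | cons w l =>
      rw [List.isChain_cons_cons] at h3
      exact (ih rfl (by simpa using h2) h3.2).trans (hπ _ h3.1)

theorem isPath_singleton (x : ι ⊕ κ) : G.IsPath x x [x] := by simp [IsPath]

theorem IsPath.exists_cons {x y z : ι ⊕ κ} {l : List (ι ⊕ κ)} (he : (x, y) ∈ G.arcs)
    (h : G.IsPath y z l) : ∃ l', G.IsPath x z l' := by
  obtain ⟨h1, h2, h3, h4⟩ := h
  -- If `x` already lies on the path, prepending it would close a cycle; the part of the path from
  -- `x` onwards is used instead.
  by_cases hx : x ∈ l
  · obtain ⟨s, t, rfl⟩ := List.append_of_mem hx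
    refine ⟨x :: t, rfl, ?_, (List.isChain_append.1 h3).2.1, (List.nodup_append.1 h4).2.1⟩
    rw [← h2, List.getLast?_append_of_ne_nil _ (by simp)]
  · refine ⟨x :: l, rfl, ?_, ?_, List.nodup_cons.2 ⟨hx, h4⟩⟩
    · cases l with
      | nil => simp at h1
      | cons v l => simpa using h2
    · cases l with
      | nil => simp at h1
      | cons v l =>
        obtain rfl : v = y := by simpa using h1
        exact List.isChain_cons_cons.2 ⟨he, h3⟩

theorem mem_canonical_arcs [Fintype ι] [Fintype κ] {grp : ι → Finset κ} {g : ι} {j : κ} :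
    (Sum.inl g, Sum.inr j) ∈ (canonical grp).arcs ↔ j ∈ grp g := by
  simp [canonical]

end GroupGraph

/-! ### Projections on the `ℓ₁`-ball -/

section Projection

variable {κ : Type*} {s : Finset κ} {u : κ → ℝ} {r : ℝ}

/-- The level `τ` is the Lagrange multiplier of the `ℓ₁` constraint: zero if the constraint already
holds for `u`, otherwise found by the intermediate value theorem on `[0, ∑ u]`. -/
theorem exists_threshold (s : Finset κ) (hu : ∀ j, 0 ≤ u j) (hr : 0 ≤ r) :
    ∃ τ, 0 ≤ τ ∧ ∑ j ∈ s, max (u j - τ) 0 ≤ r ∧ (τ ≠ 0 → ∑ j ∈ s, max (u j - τ) 0 = r) := by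
  by_cases h : ∑ j ∈ s, max (u j - 0) 0 ≤ r
  · exact ⟨0, le_rfl, h, fun h => absurd rfl h⟩
  · have hM : 0 ≤ ∑ j ∈ s, u j := Finset.sum_nonneg fun j _ => hu j
    have hend : ∑ j ∈ s, max (u j - ∑ i ∈ s, u i) 0 = 0 :=
      Finset.sum_eq_zero fun j hj => max_eq_right
        (sub_nonpos.2 (Finset.single_le_sum (fun i _ => hu i) hj))
    obtain ⟨τ, hτ, h'⟩ := intermediate_value_Icc' hM
      (f := fun τ => ∑ j ∈ s, max (u j - τ) 0) (by fun_prop) ⟨hend.trans_le hr, (not_le.1 h).le⟩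
    exact ⟨τ, hτ.1, h'.le, fun _ => h'⟩

/-- The quadratic gap gives both the optimality of the thresholded vector and its uniqueness. It
comes from a coordinatewise Lagrangian inequality whose multiplier terms have a non-negative sum by
complementary slackness. -/
theorem threshold_le {τ : ℝ} (hu : ∀ j, 0 ≤ u j) (hτ : 0 ≤ τ)
    (hsum : τ ≠ 0 → ∑ j ∈ s, max (u j - τ) 0 = r) {γ : κ → ℝ} (hγ : ∑ j ∈ s, |γ j| ≤ r) :
    ∑ j ∈ s, 1 / 2 * (u j - max (u j - τ) 0) ^ 2 + ∑ j ∈ s, 1 / 2 * (max (u j - τ) 0 - γ j) ^ 2 ≤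
      ∑ j ∈ s, 1 / 2 * (u j - γ j) ^ 2 := by
  have hpt (j : κ) : 1 / 2 * (u j - max (u j - τ) 0) ^ 2 + 1 / 2 * (max (u j - τ) 0 - γ j) ^ 2
      + τ * (max (u j - τ) 0 - |γ j|) ≤ 1 / 2 * (u j - γ j) ^ 2 := by
    rcases le_total (u j - τ) 0 with h | h
    · rw [max_eq_right h]
      nlinarith [mul_le_mul_of_nonneg_left (le_abs_self (γ j)) (hu j),
        mul_le_mul_of_nonneg_right (sub_nonpos.1 h) (abs_nonneg (γ j))]
    · rw [max_eq_left h]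
      nlinarith [mul_le_mul_of_nonneg_left (le_abs_self (γ j)) hτ]
  have h0 : 0 ≤ τ * (∑ j ∈ s, max (u j - τ) 0 - ∑ j ∈ s, |γ j|) := by
    rcases eq_or_ne τ 0 with h | h
    · simp [h]
    · exact mul_nonneg hτ (by rw [hsum h]; linarith)
  have h1 := Finset.sum_le_sum fun j (_ : j ∈ s) => hpt j
  rw [Finset.sum_add_distrib, Finset.sum_add_distrib] at h1
  rw [← Finset.sum_sub_distrib, Finset.mul_sum] at h0
  linarith

variable {ι : Type*} [DecidableEq ι] [DecidableEq κ] {η : ι → ℝ} {lam : ℝ} {G : GroupGraph ι κ}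

theorem radius_nonneg (hη : ∀ g, 0 < η g) (hlam : 0 ≤ lam) (G : GroupGraph ι κ) :
    0 ≤ lam * ∑ g ∈ G.groups, η g :=
  mul_nonneg hlam (Finset.sum_nonneg fun g _ => (hη g).le)

theorem exists_isProjection (hu : ∀ j, 0 ≤ u j) (hη : ∀ g, 0 < η g) (hlam : 0 ≤ lam)
    (G : GroupGraph ι κ) : ∃ γ, IsProjection u η lam G γ := by
  obtain ⟨τ, hτ, hle, heq⟩ := exists_threshold G.vars hu (radius_nonneg hη hlam G)
  refine ⟨fun j => max (u j - τ) 0, ?_, fun γ hγ => ?_⟩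
  · simpa only [abs_of_nonneg (le_max_right _ (0 : ℝ))] using hle
  · have h0 : 0 ≤ ∑ j ∈ G.vars, 1 / 2 * (max (u j - τ) 0 - γ j) ^ 2 :=
      Finset.sum_nonneg fun j _ => by positivity
    linarith [threshold_le hu hτ heq hγ]

theorem IsProjection.exists_threshold {γ : κ → ℝ} (h : IsProjection u η lam G γ)
    (hu : ∀ j, 0 ≤ u j) (hη : ∀ g, 0 < η g) (hlam : 0 ≤ lam) :
    ∃ τ, 0 ≤ τ ∧ (∀ j ∈ G.vars, γ j = max (u j - τ) 0) ∧
      (τ ≠ 0 → ∑ j ∈ G.vars, γ j = lam * ∑ g ∈ G.groups, η g) := by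
  obtain ⟨τ, hτ, hle, heq⟩ := ProxFlow.exists_threshold G.vars hu (radius_nonneg hη hlam G)
  have h1 := threshold_le hu hτ heq h.1
  have h2 := h.2 (fun j => max (u j - τ) 0)
    (by simpa only [abs_of_nonneg (le_max_right _ (0 : ℝ))] using hle)
  have hnn : ∀ j ∈ G.vars, 0 ≤ 1 / 2 * (max (u j - τ) 0 - γ j) ^ 2 := fun j _ => by positivity
  have h3 := (Finset.sum_eq_zero_iff_of_nonneg hnn).1
    (le_antisymm (by linarith) (Finset.sum_nonneg hnn))
  have h4 : ∀ j ∈ G.vars, γ j = max (u j - τ) 0 := fun j hj => by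
    have := h3 j hj
    have : max (u j - τ) 0 - γ j = 0 := by simpa using this
    linarith
  exact ⟨τ, hτ, h4, fun h0 => (Finset.sum_congr rfl h4).trans (heq h0)⟩

end Projection

/-! ### Optimality certificates -/

section Certificate

variable {ι κ : Type*} [DecidableEq ι] [DecidableEq κ] {u : κ → ℝ} {η : ι → ℝ} {lam : ℝ}
  {G : GroupGraph ι κ}

/-- A flow with the values `ξ` on the arcs `(j, t)`, together with a potential `π` that satisfies
the complementary slackness conditions of the quadratic min-cost flow problem. -/
structure IsCertificate (u : κ → ℝ) (η : ι → ℝ) (lam : ℝ) (G : GroupGraph ι κ) (ξ : κ → ℝ)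
    (a : ι → ℝ) (x : (ι ⊕ κ) × (ι ⊕ κ) → ℝ) (π : ι ⊕ κ → ℝ) : Prop where
  balanced : G.IsBalanced a x ξ
  source_nonneg : ∀ g ∈ G.groups, 0 ≤ a g
  source_le : ∀ g ∈ G.groups, a g ≤ lam * η g
  arc_nonneg : ∀ e ∈ G.arcs, 0 ≤ x e
  sink_nonneg : ∀ j ∈ G.vars, 0 ≤ ξ j
  pot_nonneg : ∀ v ∈ G.verts, 0 ≤ π v
  pot_le : ∀ e ∈ G.arcs, π e.2 ≤ π e.1
  pot_eq : ∀ e ∈ G.arcs, x e ≠ 0 → π e.1 = π e.2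
  source_eq : ∀ g ∈ G.groups, π (Sum.inl g) ≠ 0 → a g = lam * η g
  residual_le : ∀ j ∈ G.vars, u j - ξ j ≤ π (Sum.inr j)
  residual_eq : ∀ j ∈ G.vars, ξ j ≠ 0 → u j - ξ j = π (Sum.inr j)

namespace IsCertificate

variable {ξ : κ → ℝ} {a : ι → ℝ} {x : (ι ⊕ κ) × (ι ⊕ κ) → ℝ} {π : ι ⊕ κ → ℝ}

/-- Flow stays inside level sets of `π`, so conservation holds with any weight depending on the
potential alone. Indicators of half-lines are the main use. -/
theorem sum_mul_comp_pot (h : IsCertificate u η lam G ξ a x π) (F : ℝ → ℝ) :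
    ∑ j ∈ G.vars, ξ j * F (π (Sum.inr j)) = ∑ g ∈ G.groups, a g * F (π (Sum.inl g)) := by
  rw [← h.balanced fun v => F (π v), left_eq_add]
  refine Finset.sum_eq_zero fun e he => ?_
  rcases eq_or_ne (x e) 0 with h0 | h0
  · rw [h0, zero_mul]
  · rw [h.pot_eq e he h0, sub_self, mul_zero]

theorem sum_mul_residual (h : IsCertificate u η lam G ξ a x π) :
    ∑ j ∈ G.vars, ξ j * (u j - ξ j) = ∑ g ∈ G.groups, lam * η g * π (Sum.inl g) := by
  have h1 : ∑ j ∈ G.vars, ξ j * (u j - ξ j) = ∑ j ∈ G.vars, ξ j * π (Sum.inr j) := by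
    refine Finset.sum_congr rfl fun j hj => ?_
    rcases eq_or_ne (ξ j) 0 with h0 | h0
    · simp [h0]
    · rw [h.residual_eq j hj h0]
  rw [h1, h.sum_mul_comp_pot fun y => y]
  refine Finset.sum_congr rfl fun g hg => ?_
  rcases eq_or_ne (π (Sum.inl g)) 0 with h0 | h0
  · simp [h0]
  · rw [h.source_eq g hg h0]

theorem residual_nonneg (h : IsCertificate u η lam G ξ a x π) (hu : ∀ j, 0 ≤ u j) {j : κ}
    (hj : j ∈ G.vars) : 0 ≤ u j - ξ j := by
  rcases eq_or_ne (ξ j) 0 with h0 | h0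
  · simpa [h0] using hu j
  · rw [h.residual_eq j hj h0]
    exact h.pot_nonneg _ (GroupGraph.mem_vars.1 hj)

variable {b : ι → ℝ} {y : (ι ⊕ κ) × (ι ⊕ κ) → ℝ} {z : κ → ℝ} {τ : ℝ}

/-- If some flow has the thresholded values on the arcs to the sink, then the optimal residuals
are at most the threshold. -/
theorem residual_le_of_threshold (h : IsCertificate u η lam G ξ a x π) (hτ : 0 ≤ τ)
    (hbal : G.IsBalanced b y z) (hb : ∀ g ∈ G.groups, b g ≤ lam * η g)
    (hy : ∀ e ∈ G.arcs, 0 ≤ y e) (hz : ∀ j ∈ G.vars, z j = max (u j - τ) 0) :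
    ∀ j ∈ G.vars, u j - ξ j ≤ τ := by
  intro j hj
  by_contra! hlt
  -- On the set where `π > τ`, the certificate's flow fills the source arcs and delivers everything
  -- inside. The flow `y` can only leak out of this set, so it delivers no more there, whereas a
  -- residual above `τ` would force `z` to exceed `ξ` in total.
  let F : ℝ → ℝ := fun r => if τ < r then 1 else 0
  have hF0 (r : ℝ) : 0 ≤ F r := by simp only [F]; split_ifs <;> norm_num
  have hFmono : Monotone F := by
    intro r r' hr
    by_cases h1 : τ < r
    · simp [F, h1, h1.trans_le hr]
    · simpa [F, h1] using hF0 r'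
  have h1 := h.sum_mul_comp_pot F
  have h2 := hbal.sum_mul_le (π := fun v => F (π v)) hy hb
    (fun e he => hFmono (h.pot_le e he)) (fun g _ => hF0 _)
  have h3 : ∑ g ∈ G.groups, a g * F (π (Sum.inl g)) =
      ∑ g ∈ G.groups, lam * η g * F (π (Sum.inl g)) := by
    refine Finset.sum_congr rfl fun g hg => ?_
    by_cases hg' : τ < π (Sum.inl g)
    · rw [h.source_eq g hg (hτ.trans_lt hg').ne']
    · simp [F, hg']
  have h4 : ∑ j ∈ G.vars, ξ j * F (π (Sum.inr j)) < ∑ j ∈ G.vars, z j * F (π (Sum.inr j)) := by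
    refine Finset.sum_lt_sum (fun i hi => ?_) ⟨j, hj, ?_⟩
    · by_cases hi' : τ < π (Sum.inr i)
      · refine mul_le_mul_of_nonneg_right ?_ (hF0 _)
        rw [hz i hi]
        rcases eq_or_ne (ξ i) 0 with h0 | h0
        · rw [h0]; exact le_max_right _ _
        · refine le_trans ?_ (le_max_left _ _)
          linarith [h.residual_eq i hi h0]
      · simp [F, hi']
    · have hj' : τ < π (Sum.inr j) := hlt.trans_le (h.residual_le j hj)
      simp only [F, hj', if_true, mul_one, hz j hj]
      exact lt_of_lt_of_le (by linarith) (le_max_left _ _)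
  linarith

/-- If some flow fills all arcs from the source and is at most the thresholded vector at the sink,
then the residual of every variable that the optimal flow reaches is at least the threshold. -/
theorem threshold_le_residual (h : IsCertificate u η lam G ξ a x π)
    (hbal : G.IsBalanced b y z) (hb : ∀ g ∈ G.groups, b g = lam * η g)
    (hy : ∀ e ∈ G.arcs, 0 ≤ y e) (hz : ∀ j ∈ G.vars, z j ≤ max (u j - τ) 0) :
    (∀ j ∈ G.vars, ξ j ≠ 0 → τ ≤ u j - ξ j) ∧
      ∀ g ∈ G.groups, π (Sum.inl g) < τ → a g = lam * η g := by
  -- On the set where `π < τ`, arcs of `y` can only enter, so `z` delivers at least the full source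
  -- capacity of the set. Since `z ≤ ξ` there, all the comparisons are equalities, which yields both
  -- claims.
  let F : ℝ → ℝ := fun r => if r < τ then 1 else 0
  have hF0 (r : ℝ) : 0 ≤ F r := by simp only [F]; split_ifs <;> norm_num
  have hFanti : Antitone F := by
    intro r r' hr
    by_cases h1 : r' < τ
    · simp [F, h1, hr.trans_lt h1]
    · simpa [F, h1] using hF0 r
  have h1 := h.sum_mul_comp_pot F
  have h2 := hbal fun v => F (π v)
  have h2' : ∑ e ∈ G.arcs, y e * (F (π e.1) - F (π e.2)) ≤ 0 :=
    Finset.sum_nonpos fun e he => mul_nonpos_of_nonneg_of_nonpos (hy e he)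
      (sub_nonpos.2 (hFanti (h.pot_le e he)))
  have h3 : ∑ g ∈ G.groups, b g * F (π (Sum.inl g)) =
      ∑ g ∈ G.groups, lam * η g * F (π (Sum.inl g)) :=
    Finset.sum_congr rfl fun g hg => by rw [hb g hg]
  have hg4 : ∀ g ∈ G.groups, a g * F (π (Sum.inl g)) ≤ lam * η g * F (π (Sum.inl g)) :=
    fun g hg => mul_le_mul_of_nonneg_right (h.source_le g hg) (hF0 _)
  have hj4 : ∀ j ∈ G.vars, z j * F (π (Sum.inr j)) ≤ ξ j * F (π (Sum.inr j)) := by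
    intro j hj
    by_cases hj' : π (Sum.inr j) < τ
    · refine mul_le_mul_of_nonneg_right ((hz j hj).trans (max_le ?_ (h.sink_nonneg j hj))) (hF0 _)
      linarith [h.residual_le j hj]
    · simp [F, hj']
  have hg5 := Finset.sum_le_sum hg4
  have hj5 := Finset.sum_le_sum hj4
  refine ⟨fun j hj h0 => ?_, fun g hg hlt => ?_⟩
  · by_contra! hlt
    have hj' : π (Sum.inr j) < τ := by rwa [← h.residual_eq j hj h0]
    have : ∑ j ∈ G.vars, z j * F (π (Sum.inr j)) < ∑ j ∈ G.vars, ξ j * F (π (Sum.inr j)) := by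
      refine Finset.sum_lt_sum hj4 ⟨j, hj, ?_⟩
      simp only [F, hj', if_true, mul_one]
      exact (hz j hj).trans_lt
        (max_lt (by linarith) (lt_of_le_of_ne (h.sink_nonneg j hj) h0.symm))
    linarith
  · by_contra hne
    have : ∑ g ∈ G.groups, a g * F (π (Sum.inl g)) <
        ∑ g ∈ G.groups, lam * η g * F (π (Sum.inl g)) := by
      refine Finset.sum_lt_sum hg4 ⟨g, hg, ?_⟩
      simp only [F, hlt, if_true, mul_one]
      exact lt_of_le_of_ne (h.source_le g hg) hne
    linarith

theorem min_pot (h : IsCertificate u η lam G ξ a x π) (hτ : 0 ≤ τ)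
    (hle : ∀ j ∈ G.vars, u j - ξ j ≤ τ) :
    IsCertificate u η lam G ξ a x fun v => min (π v) τ where
  __ := h
  pot_nonneg v hv := le_min (h.pot_nonneg v hv) hτ
  pot_le e he := min_le_min_right _ (h.pot_le e he)
  pot_eq e he h0 := by rw [h.pot_eq e he h0]
  source_eq g hg h0 := h.source_eq g hg fun h1 => h0 (by rw [h1, min_eq_left hτ])
  residual_le j hj := le_min (h.residual_le j hj) (hle j hj)
  residual_eq j hj h0 := by
    rw [← h.residual_eq j hj h0, min_eq_left (hle j hj)]

/-- Raising the potential may make it nonzero at new groups, hence the need for full source arcs at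
every group below `τ`. -/
theorem max_pot (h : IsCertificate u η lam G ξ a x π)
    (hle : ∀ j ∈ G.vars, ξ j ≠ 0 → τ ≤ u j - ξ j)
    (hsat : ∀ g ∈ G.groups, π (Sum.inl g) < τ → a g = lam * η g) :
    IsCertificate u η lam G ξ a x fun v => max (π v) τ where
  __ := h
  pot_nonneg v hv := le_max_of_le_left (h.pot_nonneg v hv)
  pot_le e he := max_le_max_right _ (h.pot_le e he)
  pot_eq e he h0 := by rw [h.pot_eq e he h0]
  source_eq g hg h0 := by
    rcases lt_or_ge (π (Sum.inl g)) τ with h1 | h1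
    · exact hsat g hg h1
    · exact h.source_eq g hg (by rwa [max_eq_left h1] at h0)
  residual_le j hj := le_max_of_le_left (h.residual_le j hj)
  residual_eq j hj h0 := by
    rw [← h.residual_eq j hj h0, max_eq_left (hle j hj h0)]

/-- Certificates on the two sides of a cut fit together if no arc leaves the first side and the
potentials are separated by a constant. -/
theorem merge {P : ι ⊕ κ → Prop} [DecidablePred P] {ξ' : κ → ℝ} {a' : ι → ℝ}
    {x' : (ι ⊕ κ) × (ι ⊕ κ) → ℝ} {π' : ι ⊕ κ → ℝ}
    (h : IsCertificate u η lam (G.induce P) ξ a x π)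
    (h' : IsCertificate u η lam (G.induce fun v => ¬ P v) ξ' a' x' π')
    (hP : ∀ e ∈ G.arcs, P e.1 → P e.2) (hπ : ∀ v, π v ≤ τ) (hπ' : ∀ v, τ ≤ π' v) :
    IsCertificate u η lam G (fun j => if P (Sum.inr j) then ξ j else ξ' j)
      (fun g => if P (Sum.inl g) then a g else a' g)
      (fun e => if P e.1 ∧ P e.2 then x e else if ¬ P e.1 ∧ ¬ P e.2 then x' e else 0)
      (fun v => if P v then π v else π' v) := by
  have hg {g} (hg : g ∈ G.groups) (hp : P (Sum.inl g)) : g ∈ (G.induce P).groups := by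
    rw [GroupGraph.groups_induce]; exact Finset.mem_filter.2 ⟨hg, hp⟩
  have hg' {g} (hg : g ∈ G.groups) (hp : ¬ P (Sum.inl g)) :
      g ∈ (G.induce fun v => ¬ P v).groups := by
    rw [GroupGraph.groups_induce]; exact Finset.mem_filter.2 ⟨hg, hp⟩
  have hj {j} (hj : j ∈ G.vars) (hp : P (Sum.inr j)) : j ∈ (G.induce P).vars := by
    rw [GroupGraph.vars_induce]; exact Finset.mem_filter.2 ⟨hj, hp⟩
  have hj' {j} (hj : j ∈ G.vars) (hp : ¬ P (Sum.inr j)) :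
      j ∈ (G.induce fun v => ¬ P v).vars := by
    rw [GroupGraph.vars_induce]; exact Finset.mem_filter.2 ⟨hj, hp⟩
  have he {e} (he : e ∈ G.arcs) (h1 : P e.1) (h2 : P e.2) : e ∈ (G.induce P).arcs :=
    Finset.mem_filter.2 ⟨he, h1, h2⟩
  have he' {e} (he : e ∈ G.arcs) (h1 : ¬ P e.1) (h2 : ¬ P e.2) :
      e ∈ (G.induce fun v => ¬ P v).arcs :=
    Finset.mem_filter.2 ⟨he, h1, h2⟩
  refine ⟨h.balanced.merge h'.balanced, ?_, ?_, ?_, ?_, ?_, ?_, ?_, ?_, ?_, ?_⟩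
  · intro g hm
    by_cases hp : P (Sum.inl g)
    · simpa [hp] using h.source_nonneg g (hg hm hp)
    · simpa [hp] using h'.source_nonneg g (hg' hm hp)
  · intro g hm
    by_cases hp : P (Sum.inl g)
    · simpa [hp] using h.source_le g (hg hm hp)
    · simpa [hp] using h'.source_le g (hg' hm hp)
  · intro e hm
    by_cases h1 : P e.1 <;> by_cases h2 : P e.2 <;> simp only [h1, h2, and_true, and_false,
      not_true, not_false_iff, if_true, if_false, le_refl]
    · exact h.arc_nonneg e (he hm h1 h2)
    · exact h'.arc_nonneg e (he' hm h1 h2)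
  · intro j hm
    by_cases hp : P (Sum.inr j)
    · simpa [hp] using h.sink_nonneg j (hj hm hp)
    · simpa [hp] using h'.sink_nonneg j (hj' hm hp)
  · intro v hm
    by_cases hp : P v
    · simpa [hp] using h.pot_nonneg v (Finset.mem_filter.2 ⟨hm, hp⟩)
    · simpa [hp] using h'.pot_nonneg v (Finset.mem_filter.2 ⟨hm, hp⟩)
  · intro e hm
    by_cases h2 : P e.2 <;> by_cases h1 : P e.1 <;> simp only [h1, h2, if_true, if_false]
    · exact h.pot_le e (he hm h1 h2)
    · exact (hπ _).trans (hπ' _)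
    · exact absurd (hP e hm h1) h2
    · exact h'.pot_le e (he' hm h1 h2)
  · intro e hm
    by_cases h2 : P e.2 <;> by_cases h1 : P e.1 <;> simp only [h1, h2, and_true, and_false,
      not_true, not_false_iff, if_true, if_false, ne_eq, false_imp_iff]
    · exact h.pot_eq e (he hm h1 h2)
    · exact h'.pot_eq e (he' hm h1 h2)
  · intro g hm
    by_cases hp : P (Sum.inl g)
    · simpa [hp] using h.source_eq g (hg hm hp)
    · simpa [hp] using h'.source_eq g (hg' hm hp)
  · intro j hm
    by_cases hp : P (Sum.inr j)
    · simpa [hp] using h.residual_le j (hj hm hp)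
    · simpa [hp] using h'.residual_le j (hj' hm hp)
  · intro j hm
    by_cases hp : P (Sum.inr j)
    · simpa [hp] using h.residual_eq j (hj hm hp)
    · simpa [hp] using h'.residual_eq j (hj' hm hp)

theorem congr (h : IsCertificate u η lam G ξ a x π) {ξ' : κ → ℝ}
    (hξ : ∀ j ∈ G.vars, ξ' j = ξ j) : IsCertificate u η lam G ξ' a x π where
  __ := h
  balanced := h.balanced.congr hξ
  sink_nonneg j hj := by rw [hξ j hj]; exact h.sink_nonneg j hj
  residual_le j hj := by rw [hξ j hj]; exact h.residual_le j hj
  residual_eq j hj := by rw [hξ j hj]; exact h.residual_eq j hj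

/-- A certificate proves optimality for the quadratic min-cost flow problem. -/
theorem isMinCostFlow (h : IsCertificate u η lam G ξ a x π) :
    IsMinCostFlow u η lam G (GroupGraph.assemble a x ξ) := by
  refine ⟨h.balanced.isFlow_assemble h.source_nonneg h.source_le h.arc_nonneg h.sink_nonneg,
    fun f hf => ?_⟩
  have hnn := (G.forall_network_arcs _ _).1 hf.nonneg
  have hcap := (G.forall_network_arcs _ _).1 hf.le_cap
  have h1 : ∑ j ∈ G.vars, sinkFlow f j * π (Sum.inr j) ≤
      ∑ g ∈ G.groups, lam * η g * π (Sum.inl g) :=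
    (GroupGraph.isBalanced_of_isFlow hf).sum_mul_le hnn.2.1
      (fun g hg => (ENNReal.ofReal_le_ofReal_iff
        ((h.source_nonneg g hg).trans (h.source_le g hg))).1 (hcap.1 g hg))
      h.pot_le (fun g hg => h.pot_nonneg _ (GroupGraph.mem_groups.1 hg))
  rw [← h.sum_mul_residual] at h1
  have h2 : ∑ j ∈ G.vars, sinkFlow f j * (u j - ξ j) ≤
      ∑ j ∈ G.vars, sinkFlow f j * π (Sum.inr j) :=
    Finset.sum_le_sum fun j hj => mul_le_mul_of_nonneg_left (h.residual_le j hj) (hnn.2.2 j hj)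
  -- The tangent inequality for the convex cost at `ξ`; its linear part is non-negative by `h1` and
  -- `h2`.
  have h3 : ∑ j ∈ G.vars, (1 / 2 * (u j - ξ j) ^ 2
      + (ξ j * (u j - ξ j) - sinkFlow f j * (u j - ξ j))) ≤
      ∑ j ∈ G.vars, 1 / 2 * (u j - sinkFlow f j) ^ 2 :=
    Finset.sum_le_sum fun j _ => by nlinarith [sq_nonneg (ξ j - sinkFlow f j)]
  rw [Finset.sum_add_distrib, Finset.sum_sub_distrib] at h3
  change ∑ j ∈ G.vars, 1 / 2 * (u j - ξ j) ^ 2 ≤ ∑ j ∈ G.vars, 1 / 2 * (u j - sinkFlow f j) ^ 2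
  linarith

end IsCertificate

end Certificate

/-! ### The recursion -/

section Recursion

variable {ι κ : Type*} [DecidableEq ι] [DecidableEq κ] {u : κ → ℝ} {η : ι → ℝ} {lam : ℝ}
  {G : GroupGraph ι κ} {γ : κ → ℝ} {f : Node ι κ × Node ι κ → ℝ} {S : Finset (Node ι κ)}

/-- The bounds that a flow on the network of the max-flow step satisfies. -/
theorem stepNetwork_bounds (hη : ∀ g, 0 < η g) (hlam : 0 ≤ lam) (hγ : ∀ j ∈ G.vars, 0 ≤ γ j)
    (hf : (stepNetwork η lam G γ).IsFlow f) :
    (∀ g ∈ G.groups, 0 ≤ f (Node.source, Node.inner (Sum.inl g)) ∧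
      f (Node.source, Node.inner (Sum.inl g)) ≤ lam * η g) ∧
    (∀ e ∈ G.arcs, 0 ≤ f (Node.inner e.1, Node.inner e.2)) ∧
    ∀ j ∈ G.vars, 0 ≤ sinkFlow f j ∧ sinkFlow f j ≤ γ j := by
  have h1 := (G.forall_network_arcs _ _).1 hf.nonneg
  have h2 := (G.forall_network_arcs _ _).1 hf.le_cap
  exact ⟨fun g hg => ⟨h1.1 g hg,
    (ENNReal.ofReal_le_ofReal_iff (mul_nonneg hlam (hη g).le)).1 (h2.1 g hg)⟩, h1.2.1,
    fun j hj => ⟨h1.2.2 j hj, (ENNReal.ofReal_le_ofReal_iff (hγ j hj)).1 (h2.2.2 j hj)⟩⟩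

/-- Complementary slackness for the network of the max-flow step. -/
theorem stepNetwork_saturates (hη : ∀ g, 0 < η g) (hlam : 0 ≤ lam) (hγ : ∀ j ∈ G.vars, 0 ≤ γ j)
    (hf : (stepNetwork η lam G γ).IsMaxFlow f) (hS : (stepNetwork η lam G γ).IsMinCut S) :
    (∀ g ∈ G.groups, Node.inner (Sum.inl g) ∉ S →
      f (Node.source, Node.inner (Sum.inl g)) = lam * η g) ∧
    (∀ j ∈ G.vars, Node.inner (Sum.inr j) ∈ S → sinkFlow f j = γ j) ∧
    (∀ e ∈ G.arcs, Node.inner e.1 ∈ S → Node.inner e.2 ∈ S) ∧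
    ∀ e ∈ G.arcs, f (Node.inner e.1, Node.inner e.2) ≠ 0 →
      (Node.inner e.1 ∈ S ↔ Node.inner e.2 ∈ S) := by
  have hb := stepNetwork_bounds hη hlam hγ hf.1
  obtain ⟨h1, h2, h3⟩ := (G.forall_network_arcs _ _).1 (hf.saturates hS)
  have hout : ∀ e ∈ G.arcs, Node.inner e.1 ∈ S → Node.inner e.2 ∈ S := by
    intro e he h
    by_contra h'
    exact ENNReal.ofReal_ne_top (((h2 e he).1 h h').trans (GroupGraph.arcCap_inner ..))
  refine ⟨fun g hg h => ?_, fun j hj h => ?_, hout, fun e he h0 => ⟨hout e he, fun h => ?_⟩⟩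
  · exact (ENNReal.ofReal_eq_ofReal_iff (hb.1 g hg).1 (mul_nonneg hlam (hη g).le)).1
      ((h1 g hg).1 hS.1.2.1 h)
  · exact (ENNReal.ofReal_eq_ofReal_iff (hb.2.2 j hj).1 (hγ j hj)).1 ((h3 j hj).1 h hS.1.2.2)
  · by_contra h'
    exact h0 ((h2 e he).2 h' h)

theorem IsProjection.nonneg (h : IsProjection u η lam G γ) (hu : ∀ j, 0 ≤ u j)
    (hη : ∀ g, 0 < η g) (hlam : 0 ≤ lam) : ∀ j ∈ G.vars, 0 ≤ γ j := by
  obtain ⟨τ, -, h, -⟩ := h.exists_threshold hu hη hlam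
  intro j hj
  rw [h j hj]
  exact le_max_right _ _

/-- The cut around the source alone meets no arc of infinite capacity. -/
theorem exists_isMaxFlow_stepNetwork (η : ι → ℝ) (lam : ℝ) (G : GroupGraph ι κ) (γ : κ → ℝ) :
    ∃ f, (stepNetwork η lam G γ).IsMaxFlow f := by
  refine FlowNetwork.exists_isMaxFlow (S := {Node.source})
    ⟨by simp [stepNetwork, GroupGraph.network], by simp [stepNetwork, GroupGraph.network],
      by simp [stepNetwork, GroupGraph.network]⟩ ?_
  refine ENNReal.sum_ne_top.2 fun e he => ?_
  rw [Finset.mem_filter] at he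
  revert he
  rw [and_imp]
  revert e
  refine (G.forall_network_arcs _ _).2 ⟨fun g _ _ => ENNReal.ofReal_ne_top, fun e _ h => ?_,
    fun j _ _ => ENNReal.ofReal_ne_top⟩
  simp at h

/-- The total inflow equals the radius of the `ℓ₁`-ball, which is at least the sum of the sink
capacities `γ`; hence every sink arc is full. -/
theorem sinkFlow_eq_of_forall_source_eq (hη : ∀ g, 0 < η g) (hlam : 0 ≤ lam)
    (hγ : ∀ j ∈ G.vars, 0 ≤ γ j) (hproj : IsProjection u η lam G γ)
    (hf : (stepNetwork η lam G γ).IsFlow f)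
    (h : ∀ g ∈ G.groups, f (Node.source, Node.inner (Sum.inl g)) = lam * η g) :
    ∀ j ∈ G.vars, sinkFlow f j = γ j := by
  have hb := stepNetwork_bounds hη hlam hγ hf
  refine (Finset.sum_eq_sum_iff_of_le fun j hj => (hb.2.2 j hj).2).1 ?_
  refine le_antisymm (Finset.sum_le_sum fun j hj => (hb.2.2 j hj).2) ?_
  rw [(GroupGraph.isBalanced_of_isFlow hf).sum_eq, Finset.sum_congr rfl h, ← Finset.mul_sum]
  exact (Finset.sum_le_sum fun j _ => le_abs_self (γ j)).trans hproj.1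

/-- Both parts are smaller than the graph when a mismatch occurs. -/
theorem card_parts_lt (hu : ∀ j, 0 ≤ u j) (hη : ∀ g, 0 < η g) (hlam : 0 ≤ lam)
    (hstep : IsStep u η lam G γ f) (hne : Mismatch G γ f)
    (hS : (stepNetwork η lam G γ).IsMinCut S) :
    (plusPart G S).verts.card < G.verts.card ∧ (minusPart G S).verts.card < G.verts.card := by
  have hγ := hstep.1.nonneg hu hη hlam
  obtain ⟨h1, h2, -, -⟩ := stepNetwork_saturates hη hlam hγ hstep.2 hS
  obtain ⟨j, hj, hj'⟩ := hne
  constructor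
  -- A mismatched variable lies outside `S`, as the sink arcs of `V⁺` are full. If `V⁺` were empty,
  -- all source arcs would be full and no mismatch could occur.
  · exact Finset.card_lt_card (Finset.filter_ssubset.2
      ⟨Sum.inr j, GroupGraph.mem_vars.1 hj, fun h => hj' (h2 j hj h)⟩)
  · refine Finset.card_lt_card (Finset.filter_ssubset.2 ?_)
    by_contra! h
    exact hj' (sinkFlow_eq_of_forall_source_eq hη hlam hγ hstep.1 hstep.2.1
      (fun g hg => h1 g hg (h _ (GroupGraph.mem_groups.1 hg))) j hj)

theorem halts (hu : ∀ j, 0 ≤ u j) (hη : ∀ g, 0 < η g) (hlam : 0 ≤ lam) (G : GroupGraph ι κ) :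
    Halts u η lam G := by
  induction hn : G.verts.card using Nat.strong_induction_on generalizing G with
  | _ n ih =>
    subst hn
    exact Halts.intro G (exists_isProjection hu hη hlam G)
      (fun γ _ => exists_isMaxFlow_stepNetwork η lam G γ)
      (fun γ _ _ _ => (stepNetwork η lam G γ).exists_isMinCut)
      (fun γ f S hstep hne hS => ih _ (card_parts_lt hu hη hlam hstep hne hS).1 _ rfl)
      (fun γ f S hstep hne hS => ih _ (card_parts_lt hu hη hlam hstep hne hS).2 _ rfl)

theorem Halts.exists_computeFlow (h : Halts u η lam G) : ∃ ξ, ComputeFlow u η lam G ξ := by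
  induction h with
  | intro G hproj hflow hcut _ _ ihplus ihminus =>
    obtain ⟨γ, hγ⟩ := hproj
    obtain ⟨f, hf⟩ := hflow γ hγ
    by_cases hne : Mismatch G γ f
    · obtain ⟨S, hS⟩ := hcut γ f ⟨hγ, hf⟩ hne
      obtain ⟨ξplus, hplus⟩ := ihplus γ f S ⟨hγ, hf⟩ hne hS
      obtain ⟨ξminus, hminus⟩ := ihminus γ f S ⟨hγ, hf⟩ hne hS
      exact ⟨_, .split G γ f S ξplus ξminus ⟨hγ, hf⟩ hne hS hplus hminus⟩
    · exact ⟨_, .leaf G γ f ⟨hγ, hf⟩ hne⟩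

theorem IsStep.exists_isCertificate (hu : ∀ j, 0 ≤ u j) (hη : ∀ g, 0 < η g) (hlam : 0 ≤ lam)
    (hstep : IsStep u η lam G γ f) (heq : ¬ Mismatch G γ f) :
    ∃ a x π, IsCertificate u η lam G (sinkFlow f) a x π := by
  have heq : ∀ j ∈ G.vars, sinkFlow f j = γ j := by simpa [Mismatch] using heq
  obtain ⟨τ, hτ, hmax, hsum⟩ := hstep.1.exists_threshold hu hη hlam
  have hb := stepNetwork_bounds hη hlam (hstep.1.nonneg hu hη hlam) hstep.2.1
  have hbal := GroupGraph.isBalanced_of_isFlow hstep.2.1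
  refine ⟨_, _, fun _ => τ, hbal, fun g hg => (hb.1 g hg).1, fun g hg => (hb.1 g hg).2, hb.2.1,
    fun j hj => (hb.2.2 j hj).1, fun _ _ => hτ, fun _ _ => le_rfl, fun _ _ _ => rfl,
    fun g hg h0 => ?_, fun j hj => ?_, fun j hj h0 => ?_⟩
  · refine (Finset.sum_eq_sum_iff_of_le fun g hg => (hb.1 g hg).2).1 ?_ g hg
    rw [← hbal.sum_eq, Finset.sum_congr rfl heq, hsum h0, Finset.mul_sum]
  · rw [heq j hj, hmax j hj]
    linarith [le_max_left (u j - τ) 0]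
  · rw [heq j hj, hmax j hj] at h0 ⊢
    rcases max_choice (u j - τ) 0 with h | h
    · rw [h]; ring
    · exact absurd h h0

theorem ComputeFlow.exists_isCertificate (hu : ∀ j, 0 ≤ u j) (hη : ∀ g, 0 < η g) (hlam : 0 ≤ lam)
    {ξ : κ → ℝ} (h : ComputeFlow u η lam G ξ) : ∃ a x π, IsCertificate u η lam G ξ a x π := by
  induction h with
  | leaf G γ f hstep heq => exact hstep.exists_isCertificate hu hη hlam heq
  | split G γ f S ξplus ξminus hstep hne hS _ _ ihplus ihminus =>
    obtain ⟨a, x, π, hcert⟩ := ihplus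
    obtain ⟨a', x', π', hcert'⟩ := ihminus
    obtain ⟨τ, hτ, hmax, -⟩ := hstep.1.exists_threshold hu hη hlam
    have hγ := hstep.1.nonneg hu hη hlam
    have hb := stepNetwork_bounds hη hlam hγ hstep.2.1
    obtain ⟨hsource, hsink, hout, hcross⟩ := stepNetwork_saturates hη hlam hγ hstep.2 hS
    have hbal := GroupGraph.isBalanced_of_isFlow hstep.2.1
    have hle := hcert.residual_le_of_threshold hτ (hbal.induce hcross)
      (fun g hg => by
        rw [plusPart, GroupGraph.groups_induce, Finset.mem_filter] at hg
        exact (hb.1 g hg.1).2)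
      (fun e he => hb.2.1 e (Finset.mem_filter.1 he).1)
      (fun j hj => by
        rw [plusPart, GroupGraph.vars_induce, Finset.mem_filter] at hj
        rw [hsink j hj.1 hj.2, hmax j hj.1])
    have hge := hcert'.threshold_le_residual (τ := τ)
      (hbal.induce fun e he h0 => not_congr (hcross e he h0))
      (fun g hg => by
        rw [minusPart, GroupGraph.groups_induce, Finset.mem_filter] at hg
        exact hsource g hg.1 hg.2)
      (fun e he => hb.2.1 e (Finset.mem_filter.1 he).1)
      (fun j hj => by
        rw [minusPart, GroupGraph.vars_induce, Finset.mem_filter] at hj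
        rw [← hmax j hj.1]
        exact (hb.2.2 j hj.1).2)
    -- Truncation at `τ` separates the potentials, so arcs from `V⁻` to `V⁺` go downhill; they get
    -- zero flow.
    refine ⟨_, _, _, ((hcert.min_pot hτ hle).merge (hcert'.max_pot hge.1 hge.2) hout
      (fun v => min_le_right _ _) fun v => le_max_right _ _).congr fun j hj => ?_⟩
    simp [plusPart, GroupGraph.vars_induce, hj]

end Recursion

/-! ### The proximal problem -/

section Prox

variable {ι : Type*} [Fintype ι] [DecidableEq ι] {p : ℕ} {grp : ι → Finset (Fin p)} {η : ι → ℝ}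
  {lam : ℝ} {G : GroupGraph ι (Fin p)} {a : ι → ℝ}
  {x : (ι ⊕ Fin p) × (ι ⊕ Fin p) → ℝ} {ξ : Fin p → ℝ}

theorem GroupGraph.IsEquivalent.groups_eq (hG : G.IsEquivalent (GroupGraph.canonical grp)) :
    G.groups = Finset.univ := by
  ext g; simp [GroupGraph.mem_groups, hG.verts_eq, GroupGraph.canonical]

theorem GroupGraph.IsEquivalent.vars_eq (hG : G.IsEquivalent (GroupGraph.canonical grp)) :
    G.vars = Finset.univ := by
  ext g; simp [GroupGraph.mem_vars, hG.verts_eq, GroupGraph.canonical]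

/-- Vectors carried by flows pair with any vector to at most its `Ω`-norm. -/
theorem sum_mul_abs_le_omega (hG : G.IsEquivalent (GroupGraph.canonical grp))
    (hη : ∀ g, 0 < η g) (hlam : 0 ≤ lam) (hbal : G.IsBalanced a x ξ)
    (hx : ∀ e ∈ G.arcs, 0 ≤ x e) (ha : ∀ g ∈ G.groups, a g ≤ lam * η g) (hξ : ∀ j, 0 ≤ ξ j)
    (v : EuclideanSpace ℝ (Fin p)) : ∑ j, ξ j * |v j| ≤ lam * omega grp η v := by
  classical
  let R (y : ι ⊕ Fin p) : Finset (Fin p) := {j | ∃ l, G.IsPath y (Sum.inr j) l}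
  -- The largest `|v j|` over variables reachable from `y` is a potential that decreases along arcs.
  -- Equivalence to the canonical graph bounds it at `g` by the maximum over `grp g`.
  let ψ (y : ι ⊕ Fin p) : ℝ := ((R y).sup fun j => ‖v j‖₊ : ℝ≥0)
  have h := hbal.sum_mul_le (π := ψ) hx ha
    (fun e he => NNReal.coe_le_coe.2 (Finset.sup_mono fun j hj => by
      obtain ⟨l, hl⟩ := (Finset.mem_filter.1 hj).2
      exact Finset.mem_filter.2 ⟨Finset.mem_univ _, hl.exists_cons he⟩))
    (fun g _ => NNReal.coe_nonneg _)
  rw [hG.groups_eq, hG.vars_eq] at h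
  calc ∑ j, ξ j * |v j| ≤ ∑ j, ξ j * ψ (Sum.inr j) := by
        refine Finset.sum_le_sum fun j _ => mul_le_mul_of_nonneg_left ?_ (hξ j)
        have : ‖v j‖₊ ≤ (R (Sum.inr j)).sup fun j => ‖v j‖₊ :=
          Finset.le_sup (f := fun j => ‖v j‖₊)
            (Finset.mem_filter.2 ⟨Finset.mem_univ _, _, GroupGraph.isPath_singleton _⟩)
        exact NNReal.coe_le_coe.2 this
    _ ≤ ∑ g, lam * η g * ψ (Sum.inl g) := h
    _ ≤ ∑ g, lam * (η g * ((grp g).sup (fun j => ‖v j‖₊) : ℝ≥0)) := by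
        refine Finset.sum_le_sum fun g _ => ?_
        rw [mul_assoc]
        refine mul_le_mul_of_nonneg_left (mul_le_mul_of_nonneg_left ?_ (hη g).le) hlam
        refine NNReal.coe_le_coe.2 (Finset.sup_mono fun j hj => ?_)
        obtain ⟨l, hl⟩ := (Finset.mem_filter.1 hj).2
        exact GroupGraph.mem_canonical_arcs.1 (hG.arc_of_path g j l hl)
    _ = lam * omega grp η v := by rw [omega, Finset.mul_sum]

/-- The potential decreases along a path from `g` to each `j ∈ grp g`, so `π` at `g` dominates the
group maximum of `|w j|`. The weighted sum of group potentials is the pairing by `sum_mul_residual`.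
-/
theorem IsCertificate.omega_le {u : Fin p → ℝ} {π : ι ⊕ Fin p → ℝ}
    (h : IsCertificate u η lam G ξ a x π) (hG : G.IsEquivalent (GroupGraph.canonical grp))
    (hη : ∀ g, 0 < η g) (hlam : 0 ≤ lam) {w : EuclideanSpace ℝ (Fin p)}
    (hw : ∀ j, |w j| = u j - ξ j) : lam * omega grp η w ≤ ∑ j, ξ j * |w j| := by
  have h1 := h.sum_mul_residual
  rw [hG.groups_eq, hG.vars_eq] at h1
  simp only [hw, h1, omega, Finset.mul_sum]
  refine Finset.sum_le_sum fun g _ => ?_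
  rw [mul_assoc]
  refine mul_le_mul_of_nonneg_left (mul_le_mul_of_nonneg_left ?_ (hη g).le) hlam
  have h0 : 0 ≤ π (Sum.inl g) :=
    h.pot_nonneg _ (GroupGraph.mem_groups.1 (by simp [hG.groups_eq]))
  have : ((grp g).sup fun j => ‖w j‖₊) ≤ (π (Sum.inl g)).toNNReal := by
    refine Finset.sup_le fun j hj => ?_
    obtain ⟨l, hl, -⟩ := hG.unique_path g j (GroupGraph.mem_canonical_arcs.2 hj)
    refine NNReal.le_toNNReal_of_coe_le ?_
    rw [coe_nnnorm, Real.norm_eq_abs, hw]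
    exact (h.residual_le j (by simp [hG.vars_eq])).trans (GroupGraph.le_of_isPath h.pot_le hl)
  simpa [h0] using NNReal.coe_le_coe.2 this

theorem IsCertificate.proxObjective_lt {u : EuclideanSpace ℝ (Fin p)} {π : ι ⊕ Fin p → ℝ}
    (h : IsCertificate (fun j => |u j|) η lam G ξ a x π)
    (hG : G.IsEquivalent (GroupGraph.canonical grp)) (hη : ∀ g, 0 < η g) (hlam : 0 ≤ lam)
    {v : EuclideanSpace ℝ (Fin p)} (hv : v ≠ output u ξ) :
    proxObjective grp η lam u (output u ξ) < proxObjective grp η lam u v := by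
  set w := output u ξ with hw
  have hmem (j : Fin p) : j ∈ G.vars := by simp [hG.vars_eq]
  have hξ (j : Fin p) : 0 ≤ ξ j := h.sink_nonneg j (hmem j)
  have hres (j : Fin p) : 0 ≤ |u j| - ξ j := h.residual_nonneg (fun _ => abs_nonneg _) (hmem j)
  have hwj (j : Fin p) : w j = if 0 ≤ u j then u j - ξ j else u j + ξ j := rfl
  have habs (j : Fin p) : |w j| = |u j| - ξ j := by
    have := hres j
    rw [hwj]
    split_ifs with h0
    · rw [abs_of_nonneg h0] at this ⊢
      exact abs_of_nonneg this
    · rw [abs_of_neg (not_le.1 h0)] at this ⊢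
      rw [abs_of_nonpos (by linarith)]
      ring
  have h1 := h.omega_le hG hη hlam habs
  have h2 := sum_mul_abs_le_omega hG hη hlam h.balanced h.arc_nonneg h.source_le hξ v
  -- Since `u j - w j` is `ξ j` with the sign of `u j`, the cross term of the expanded square is at
  -- least `ξ j * (|w j| - |v j|)`. The leftover square gives strictness.
  have hpt (j : Fin p) : 1 / 2 * (u j - w j) ^ 2 + ξ j * |w j| + 1 / 2 * (w j - v j) ^ 2 ≤
      1 / 2 * (u j - v j) ^ 2 + ξ j * |v j| := by
    rw [habs, hwj]
    split_ifs with h0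
    · rw [abs_of_nonneg h0]
      nlinarith [mul_le_mul_of_nonneg_left (le_abs_self (v j)) (hξ j)]
    · rw [abs_of_neg (not_le.1 h0)]
      nlinarith [mul_le_mul_of_nonneg_left (neg_abs_le (v j)) (hξ j)]
  have hsum := Finset.sum_le_sum fun j (_ : j ∈ Finset.univ) => hpt j
  simp only [Finset.sum_add_distrib, ← Finset.mul_sum] at hsum
  have hpos : 0 < ∑ j, (w j - v j) ^ 2 := by
    have : 0 < ‖w - v‖ ^ 2 := pow_pos (norm_pos_iff.2 (sub_ne_zero.2 hv.symm)) 2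
    simpa [EuclideanSpace.norm_sq_eq] using this
  simp only [proxObjective, EuclideanSpace.norm_sq_eq, PiLp.sub_apply, Real.norm_eq_abs, sq_abs]
  linarith

end Prox

end ProxFlow

theorem mainTheorem1 {p : ℕ} {ι : Type*} [Fintype ι] [DecidableEq ι]
    (u : EuclideanSpace ℝ (Fin p)) (grp : ι → Finset (Fin p))
    (η : ι → ℝ) (hη : ∀ g, 0 < η g) (lam : ℝ) (hlam : 0 ≤ lam)
    (G : ProxFlow.GroupGraph ι (Fin p))
    (hG : G.IsEquivalent (ProxFlow.GroupGraph.canonical grp)) :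
    ProxFlow.Halts (fun j => |u j|) η lam G ∧
    (∃ ξ, ProxFlow.ComputeFlow (fun j => |u j|) η lam G ξ) ∧
    ∀ ξ, ProxFlow.ComputeFlow (fun j => |u j|) η lam G ξ →
      (∃ f, ProxFlow.IsMinCostFlow (fun j => |u j|) η lam G f ∧
        ∀ j, ProxFlow.sinkFlow f j = ξ j) ∧
      ∀ v, v ≠ ProxFlow.output u ξ →
        ProxFlow.proxObjective grp η lam u (ProxFlow.output u ξ)
          < ProxFlow.proxObjective grp η lam u v := by
  have hu : ∀ j, 0 ≤ (fun j => |u j|) j := fun j => abs_nonneg _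
  have hhalt := ProxFlow.halts hu hη hlam G
  refine ⟨hhalt, hhalt.exists_computeFlow, fun ξ hξ => ?_⟩
  obtain ⟨a, x, π, h⟩ := hξ.exists_isCertificate hu hη hlam
  exact ⟨⟨_, h.isMinCostFlow, fun j => rfl⟩, fun v hv => h.proxObjective_lt hG hη hlam hv⟩
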